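/- Let $n\ge 1$ and let $K\in\mathbb R^{n\times n}$ be symmetric positive definite (for instance $K=XX^\top/n$, where the rows of $X\in\mathbb R^{n\times d}$ are the input data and $K$ has rank $n$), with eigenvalues $\lambda^K_1\ge\dots\ge\lambda^K_n>0$. Let $0<\alpha<1/\lambda^K_1$, $K_d=I-\alpha K$, let $y\in\mathbb R^n$ be a nonzero vector (the targets), and let $T\ge 1$ be an integer. Put $$P_1^y(T)=\frac1T\sum_{t=0}^{T-1}K_d^t\,yy^\top K_d^t ,$$ and let $\lambda^y_1\ge\dots\ge\lambda^y_n$ be the eigenvalues, counted with multiplicity, of the symmetric matrix $T\,P_1^y(T)$. Then for every integer $i\ge 0$ with $1+2i\le n$, $$\frac{\lambda^y_{1+2i}}{\lambda^y_1}\le\frac{4\rho^{-2i}}{(1+\rho^{-4i})^2}<4\rho^{-2i},\qquad \rho=\exp\left(\frac{\pi^2}{2\ln\bigl(8\lambda^K_1/\lambda^K_n-4\bigr)}\right).$$ -/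

import Mathlib

/-- The `j`-th largest eigenvalue (counted with multiplicity, `1 ≤ j ≤ n`) of a real symmetric
`n × n` matrix. Mathlib's `eigenvalues₀` lists the eigenvalues in decreasing order from index `0`. -/
noncomputable def eigDesc {n : ℕ} {A : Matrix (Fin n) (Fin n) ℝ} (hA : A.IsHermitian)
    (j : ℕ) (h1 : 1 ≤ j) (hn : j ≤ n) : ℝ :=
  hA.eigenvalues₀ ⟨j - 1, by rw [Fintype.card_fin]; omega⟩

/-- `K_d = I - α K`. -/
def stepMatrix {n : ℕ} (K : Matrix (Fin n) (Fin n) ℝ) (α : ℝ) : Matrix (Fin n) (Fin n) ℝ :=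
  1 - α • K

/-- `P_1^y(T) = (1/T) ∑_{t=0}^{T-1} K_d^t y yᵀ K_d^t`. -/
noncomputable def targetPCA {n : ℕ} (K : Matrix (Fin n) (Fin n) ℝ) (α : ℝ) (y : Fin n → ℝ)
    (T : ℕ) : Matrix (Fin n) (Fin n) ℝ :=
  (1 / (T : ℝ)) • ∑ t ∈ Finset.range T,
    stepMatrix K α ^ t * Matrix.vecMulVec y y * stepMatrix K α ^ t

/-- `ρ = exp (π² / (2 ln (8 l₁ / lₙ - 4)))`, where `l₁` and `lₙ` are the largest and the smallest
eigenvalue of `K`. -/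
noncomputable def decayRate (l₁ lₙ : ℝ) : ℝ :=
  Real.exp (Real.pi ^ 2 / (2 * Real.log (8 * l₁ / lₙ - 4)))

/-- `T • P_1^y(T)` is symmetric, so that its ordered eigenvalues make sense. -/
theorem isHermitian_smul_targetPCA {n : ℕ} {K : Matrix (Fin n) (Fin n) ℝ} (hK : K.IsHermitian)
    (α : ℝ) (y : Fin n → ℝ) (T : ℕ) : ((T : ℝ) • targetPCA K α y T).IsHermitian := by
  have hd : (stepMatrix K α).IsHermitian :=
    Matrix.isHermitian_one.sub (hK.smul (IsSelfAdjoint.all α))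
  have hy : (Matrix.vecMulVec y y).IsHermitian := by
    ext i j
    simp [Matrix.vecMulVec_apply, Matrix.conjTranspose_apply, mul_comm]
  refine Matrix.IsHermitian.smul (Matrix.IsHermitian.smul ?_ (IsSelfAdjoint.all _))
    (IsSelfAdjoint.all _)
  unfold Matrix.IsHermitian
  rw [Matrix.conjTranspose_sum]
  refine Finset.sum_congr rfl fun t _ => ?_
  rw [Matrix.conjTranspose_mul, Matrix.conjTranspose_mul, Matrix.conjTranspose_pow, hd.eq, hy.eq,
    Matrix.mul_assoc]

/-! Write `D` for the step matrix and `M = T • P`. The sum defining `M` telescopes to the Stein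
equation `M - D M D = y yᵀ - D^T y yᵀ D^T`, whose right-hand side has rank at most 2. After `i`
alternating direction steps with shifts `d j`, polynomials `U` and `V` in `D` satisfy `rank (U M U -
V M V) ≤ 2 i` (`rank_adi_le`). On the kernel of this difference the quadratic form of `M` at `U z`
equals that at `V z`, hence is at most `λ₁ ‖V z‖² ≤ λ₁ B ‖U z‖²`, where `B` bounds `(V / U)²` on the
spectrum of `D`. Since `U` is injective, Courant–Fischer gives `λ_{1+2i} ≤ B λ₁`
(`eigenvalues_le_of_stein`).

It remains to choose shifts with `B` small. The Cayley transform `(1 - μ) / (1 + μ)` and a scaling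
move the spectrum into `[1/√κ, √κ]` with `κ = 2 λ₁ᴷ / λₙᴷ - 1`, and `V / U` becomes `∏ (1 - d j x) /
(1 + d j x)`: Zolotarev's third problem (`exists_zolotarev_bound`). Parametrize `x` and the `d j` by
the theta quotient `thetaOdd / thetaEven`. The addition formula turns each factor into a ratio of
theta products, and multisection, a consequence of Jacobi's triple product, collapses the whole
product to `θ(-w) / θ(w)` at a nome `g` with `g ^ (2 k) = 1 / (4 κ)`. Poisson summation rewrites
this ratio at the dual nome `s ^ 4`, where leading terms and geometric tails give the bound `2 s /
(1 + s ^ 4)`. Its square is the claimed constant, with `s = ρ ^ (-i)`. -/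

/-! ### Theta series: convergence, parity split, addition formula. -/

/-- The bilateral theta series `∑ r ^ (n ^ 2) * w ^ n` over the integers. -/
noncomputable def thetaSeries (r w : ℝ) : ℝ := ∑' n : ℤ, r ^ (n ^ 2) * w ^ n

/-- The part of the theta series with even index. -/
noncomputable def thetaEven (p w : ℝ) : ℝ := ∑' n : ℤ, p ^ ((2 * n) ^ 2) * w ^ (2 * n)

/-- The part of the theta series with odd index. -/
noncomputable def thetaOdd (p w : ℝ) : ℝ := ∑' n : ℤ, p ^ ((2 * n + 1) ^ 2) * w ^ (2 * n + 1)

/-- The terms are the norms of Jacobi theta terms with purely imaginary `z` and `τ`. -/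
theorem summable_theta_of_pos {r w : ℝ} (hr : 0 < r) (hr1 : r < 1) (hw : 0 < w) :
    Summable fun n : ℤ => r ^ (n ^ 2) * w ^ n := by
  have hτ : 0 < (Complex.I * ((-Real.log r / Real.pi : ℝ) : ℂ)).im := by
    simpa using div_pos (neg_pos.2 (Real.log_neg hr hr1)) Real.pi_pos
  have h := ((summable_jacobiTheta₂_term_iff
    (Complex.I * ((-Real.log w / (2 * Real.pi) : ℝ) : ℂ)) _).2 hτ).norm
  refine h.congr fun n => ?_
  rw [norm_jacobiTheta₂_term]
  simp only [Complex.mul_im, Complex.I_re, Complex.I_im, Complex.ofReal_re, Complex.ofReal_im,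
    zero_mul, one_mul, zero_add]
  rw [← Real.rpow_intCast r, ← Real.rpow_intCast w, Real.rpow_def_of_pos hr,
    Real.rpow_def_of_pos hw, ← Real.exp_add]
  congr 1
  have := Real.pi_ne_zero
  push_cast
  field_simp
  ring

theorem summable_abs_theta {r w : ℝ} (hr : 0 < r) (hr1 : r < 1) (hw : w ≠ 0) :
    Summable fun n : ℤ => |r ^ (n ^ 2) * w ^ n| := by
  refine (summable_theta_of_pos hr hr1 (abs_pos.2 hw)).congr fun n => ?_
  rw [abs_mul, abs_zpow, abs_zpow, abs_of_pos hr]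

theorem summable_theta {r w : ℝ} (hr : 0 < r) (hr1 : r < 1) (hw : w ≠ 0) :
    Summable fun n : ℤ => r ^ (n ^ 2) * w ^ n :=
  (summable_abs_theta hr hr1 hw).of_abs

theorem injective_two_mul_int : Function.Injective fun n : ℤ => 2 * n :=
  fun a b h => by simpa using h

theorem injective_two_mul_add_one_int : Function.Injective fun n : ℤ => 2 * n + 1 :=
  fun a b h => by simpa using h

theorem summable_abs_thetaEven {p w : ℝ} (hp : 0 < p) (hp1 : p < 1) (hw : w ≠ 0) :
    Summable fun n : ℤ => |p ^ ((2 * n) ^ 2) * w ^ (2 * n)| :=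
  (summable_abs_theta hp hp1 hw).comp_injective injective_two_mul_int

theorem summable_abs_thetaOdd {p w : ℝ} (hp : 0 < p) (hp1 : p < 1) (hw : w ≠ 0) :
    Summable fun n : ℤ => |p ^ ((2 * n + 1) ^ 2) * w ^ (2 * n + 1)| :=
  (summable_abs_theta hp hp1 hw).comp_injective injective_two_mul_add_one_int

theorem thetaSeries_pos {r w : ℝ} (hr : 0 < r) (hr1 : r < 1) (hw : 0 < w) :
    0 < thetaSeries r w :=
  (summable_theta hr hr1 hw.ne').tsum_pos (fun n => by positivity) 0 (by positivity)

theorem thetaEven_pos {p w : ℝ} (hp : 0 < p) (hp1 : p < 1) (hw : 0 < w) :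
    0 < thetaEven p w :=
  (summable_abs_thetaEven hp hp1 hw.ne').of_abs.tsum_pos (fun n => by positivity) 0 (by positivity)

theorem thetaOdd_pos {p w : ℝ} (hp : 0 < p) (hp1 : p < 1) (hw : 0 < w) :
    0 < thetaOdd p w :=
  (summable_abs_thetaOdd hp hp1 hw.ne').of_abs.tsum_pos (fun n => by positivity) 0 (by positivity)

theorem thetaEven_neg (p w : ℝ) : thetaEven p (-w) = thetaEven p w := by
  refine tsum_congr fun n => ?_
  rw [(even_two_mul n).neg_zpow]

theorem thetaOdd_neg (p w : ℝ) : thetaOdd p (-w) = -thetaOdd p w := by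
  rw [thetaOdd, thetaOdd, ← tsum_neg]
  refine tsum_congr fun n => ?_
  rw [(odd_two_mul_add_one n).neg_zpow, mul_neg]

/-- Pairs of integers, split by the parity of their sum, are parametrized by half their sum and
half their difference. -/
def intPairParityEquiv : (ℤ × ℤ) ⊕ (ℤ × ℤ) ≃ ℤ × ℤ where
  toFun := Sum.elim (fun x => (x.1 + x.2, x.1 - x.2)) (fun x => (x.1 + x.2 + 1, x.1 - x.2))
  invFun x := if (x.1 + x.2) % 2 = 0 then Sum.inl ((x.1 + x.2) / 2, (x.1 - x.2) / 2)
    else Sum.inr ((x.1 + x.2 - 1) / 2, (x.1 - x.2 - 1) / 2)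
  left_inv := by
    rintro (⟨a, b⟩ | ⟨a, b⟩)
    · refine (if_pos (show (a + b + (a - b)) % 2 = 0 by omega)).trans ?_
      refine congrArg Sum.inl (Prod.ext ?_ ?_)
      · change (a + b + (a - b)) / 2 = a
        omega
      · change (a + b - (a - b)) / 2 = b
        omega
    · refine (if_neg (show ¬ (a + b + 1 + (a - b)) % 2 = 0 by omega)).trans ?_
      refine congrArg Sum.inr (Prod.ext ?_ ?_)
      · change (a + b + 1 + (a - b) - 1) / 2 = a
        omega
      · change (a + b + 1 - (a - b) - 1) / 2 = b
        omega
  right_inv := by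
    rintro ⟨a, b⟩
    by_cases h : (a + b) % 2 = 0
    · simp only [h, if_true, Sum.elim_inl]
      refine Prod.ext ?_ ?_ <;> simp only <;> omega
    · simp only [h, if_false, Sum.elim_inr]
      refine Prod.ext ?_ ?_ <;> simp only <;> omega

/-- The parallelogram law `(m + n)² + (m - n)² = 2 m² + 2 n²` separates the variables; the nome on
the left is therefore `p ^ 2`. -/
theorem theta_term_mul_theta_term {p w v : ℝ} (hp : p ≠ 0) (hw : w ≠ 0) (hv : v ≠ 0)
    (m n s t : ℤ) (hs : m + n = s) (ht : m - n = t) :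
    (p ^ 2) ^ (m ^ 2) * (w * v) ^ m * ((p ^ 2) ^ (n ^ 2) * (w / v) ^ n) =
      p ^ (s ^ 2) * w ^ s * (p ^ (t ^ 2) * v ^ t) := by
  subst hs ht
  have e : (m + n) ^ 2 + (m - n) ^ 2 = 2 * m ^ 2 + 2 * n ^ 2 := by ring
  have h1 : p ^ ((m + n) ^ 2) * p ^ ((m - n) ^ 2) = (p ^ 2) ^ (m ^ 2) * (p ^ 2) ^ (n ^ 2) := by
    rw [← zpow_add₀ hp, e, zpow_add₀ hp, zpow_mul, zpow_mul]
    norm_cast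
  rw [mul_mul_mul_comm, ← h1, mul_zpow, div_zpow, zpow_add₀ hw, zpow_sub₀ hv]
  ring

theorem tsum_mul_tsum_of_parity {f g a b c d : ℤ → ℝ} (hf : Summable fun n => ‖f n‖)
    (hg : Summable fun n => ‖g n‖) (ha : Summable fun n => ‖a n‖) (hb : Summable fun n => ‖b n‖)
    (hc : Summable fun n => ‖c n‖) (hd : Summable fun n => ‖d n‖)
    (h1 : ∀ x y, f (x + y) * g (x - y) = a x * b y)
    (h2 : ∀ x y, f (x + y + 1) * g (x - y) = c x * d y) :
    (∑' n, f n) * ∑' n, g n = (∑' n, a n) * (∑' n, b n) + (∑' n, c n) * ∑' n, d n := by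
  rw [tsum_mul_tsum_of_summable_norm hf hg, tsum_mul_tsum_of_summable_norm ha hb,
    tsum_mul_tsum_of_summable_norm hc hd,
    ← intPairParityEquiv.tsum_eq fun z : ℤ × ℤ => f z.1 * g z.2]
  exact HasSum.tsum_eq (HasSum.sum
    ((summable_mul_of_summable_norm ha hb).hasSum.congr_fun fun x => h1 x.1 x.2)
    ((summable_mul_of_summable_norm hc hd).hasSum.congr_fun fun x => h2 x.1 x.2))

/-- The addition formula for theta series. -/
theorem thetaSeries_mul_thetaSeries {p w v : ℝ} (hp : 0 < p) (hp1 : p < 1) (hw : w ≠ 0)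
    (hv : v ≠ 0) :
    thetaSeries (p ^ 2) (w * v) * thetaSeries (p ^ 2) (w / v) =
      thetaEven p w * thetaEven p v + thetaOdd p w * thetaOdd p v := by
  have hr : 0 < p ^ 2 := by positivity
  have hr1 : p ^ 2 < 1 := pow_lt_one₀ hp.le hp1 two_ne_zero
  unfold thetaSeries thetaEven thetaOdd
  exact tsum_mul_tsum_of_parity (summable_abs_theta hr hr1 (mul_ne_zero hw hv))
    (summable_abs_theta hr hr1 (div_ne_zero hw hv)) (summable_abs_thetaEven hp hp1 hw)
    (summable_abs_thetaEven hp hp1 hv) (summable_abs_thetaOdd hp hp1 hw)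
    (summable_abs_thetaOdd hp hp1 hv)
    (fun x y => theta_term_mul_theta_term hp.ne' hw hv (x + y) (x - y) (2 * x) (2 * y)
      (by ring) (by ring))
    (fun x y => theta_term_mul_theta_term hp.ne' hw hv (x + y + 1) (x - y) (2 * x + 1) (2 * y + 1)
      (by ring) (by ring))

theorem thetaSeries_neg_mul_thetaSeries_neg {p w v : ℝ} (hp : 0 < p) (hp1 : p < 1) (hw : w ≠ 0)
    (hv : v ≠ 0) :
    thetaSeries (p ^ 2) (-w * v) * thetaSeries (p ^ 2) (-w / v) =
      thetaEven p w * thetaEven p v - thetaOdd p w * thetaOdd p v := by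
  rw [thetaSeries_mul_thetaSeries hp hp1 (neg_ne_zero.2 hw) hv, thetaEven_neg, thetaOdd_neg]
  ring

/-- Completing the square: `1 + (2n)² + 2 (2n) = (2n + 1)²`. With `thetaOdd_sq_self`, the quotient
`thetaOdd / thetaEven` takes reciprocal values at `1` and `p ^ 2`, which fixes the range used in the
intermediate value argument. -/
theorem thetaEven_sq_self {p : ℝ} (hp : 0 < p) : p * thetaEven p (p ^ 2) = thetaOdd p 1 := by
  rw [thetaEven, thetaOdd, ← tsum_mul_left]
  refine tsum_congr fun n => ?_
  rw [one_zpow, mul_one, ← zpow_natCast p 2, ← zpow_mul, ← zpow_add₀ hp.ne',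
    ← zpow_one_add₀ hp.ne']
  congr 1
  push_cast
  ring

theorem thetaOdd_sq_self {p : ℝ} (hp : 0 < p) : p * thetaOdd p (p ^ 2) = thetaEven p 1 := by
  rw [thetaEven, thetaOdd, ← tsum_mul_left, 
    ← (Equiv.addRight (1 : ℤ)).tsum_eq fun n : ℤ => p ^ ((2 * n) ^ 2) * 1 ^ (2 * n)]
  refine tsum_congr fun n => ?_
  rw [one_zpow, mul_one, ← zpow_natCast p 2, ← zpow_mul, ← zpow_add₀ hp.ne',
    ← zpow_one_add₀ hp.ne']
  congr 1
  simp only [Equiv.coe_addRight]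
  push_cast
  ring

theorem continuousOn_theta_of_injective {p : ℝ} (hp : 0 < p) (hp1 : p < 1) {e : ℤ → ℤ}
    (he : Function.Injective e) :
    ContinuousOn (fun w : ℝ => ∑' n : ℤ, p ^ (e n ^ 2) * w ^ e n) (Set.Icc (p ^ 2) 1) := by
  have hp2 : 0 < p ^ 2 := by positivity
  refine continuousOn_tsum (u := fun n => p ^ (e n ^ 2) * 1 ^ e n + p ^ (e n ^ 2) * (p ^ 2) ^ e n)
    (fun n => ?_) (((summable_theta hp hp1 one_ne_zero).comp_injective he).add
      ((summable_theta hp hp1 hp2.ne').comp_injective he)) fun n w hw => ?_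
  · exact continuousOn_const.mul
      (continuousOn_id.zpow₀ _ fun w hw => Or.inl (hp2.trans_le hw.1).ne')
  · have hw0 : 0 < w := hp2.trans_le hw.1
    rw [Real.norm_of_nonneg (by positivity), ← mul_add]
    refine mul_le_mul_of_nonneg_left ?_ (by positivity)
    -- A power is monotone in its base, in a direction set by the sign of the exponent, so one of
    -- the two endpoint values dominates it.
    rcases le_total 0 (e n) with h | h
    · exact (zpow_le_zpow_left₀ h hw0.le hw.2).trans (le_add_of_nonneg_right (by positivity))
    · refine le_trans ?_ (le_add_of_nonneg_left (by positivity))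
      have h' := zpow_le_zpow_left₀ (neg_nonneg.2 h) hp2.le hw.1
      rw [zpow_neg, zpow_neg] at h'
      exact (inv_le_inv₀ (by positivity) (by positivity)).1 h'

/-! ### Gaussian binomials and Jacobi's triple product. -/

/-- The finite `q`-Pochhammer symbol `(q; q)_N`. -/
noncomputable def qPochhammer (q : ℝ) (N : ℕ) : ℝ := ∏ m ∈ Finset.range N, (1 - q ^ (m + 1))

/-- The Gaussian binomial coefficients, defined by the `q`-Pascal recursion. -/
noncomputable def gaussBinom (q : ℝ) : ℕ → ℕ → ℝ
  | _, 0 => 1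
  | 0, _ + 1 => 0
  | M + 1, k + 1 => gaussBinom q M k + q ^ (k + 1) * gaussBinom q M (k + 1)

theorem gaussBinom_zero_right (q : ℝ) (M : ℕ) : gaussBinom q M 0 = 1 := by
  cases M <;> simp [gaussBinom]

theorem gaussBinom_eq_zero (q : ℝ) {M k : ℕ} (h : M < k) : gaussBinom q M k = 0 := by
  induction M generalizing k with
  | zero =>
    obtain ⟨k, rfl⟩ := Nat.exists_eq_succ_of_ne_zero h.ne'
    simp [gaussBinom]
  | succ M ih =>
    obtain ⟨k, rfl⟩ := Nat.exists_eq_succ_of_ne_zero (Nat.ne_zero_of_lt h)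
    rw [Nat.succ_eq_add_one, gaussBinom, ih (by omega), ih (by omega)]
    simp

theorem gaussBinom_nonneg {q : ℝ} (hq : 0 ≤ q) (M k : ℕ) : 0 ≤ gaussBinom q M k := by
  induction M generalizing k with
  | zero => cases k <;> simp [gaussBinom]
  | succ M ih =>
    cases k with
    | zero => simp [gaussBinom]
    | succ k =>
      rw [gaussBinom]
      exact add_nonneg (ih k) (mul_nonneg (by positivity) (ih (k + 1)))

theorem qPochhammer_succ (q : ℝ) (N : ℕ) :
    qPochhammer q (N + 1) = qPochhammer q N * (1 - q ^ (N + 1)) :=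
  Finset.prod_range_succ _ _

/-- The quotient formula for the Gaussian binomial, kept free of division. It supplies both the
limit and the uniform bound of the coefficients in the triple product. -/
theorem gaussBinom_mul_qPochhammer (q : ℝ) (k l : ℕ) :
    gaussBinom q (k + l) k * (qPochhammer q k * qPochhammer q l) = qPochhammer q (k + l) := by
  induction h : k + l generalizing k l with
  | zero =>
    obtain ⟨rfl, rfl⟩ : k = 0 ∧ l = 0 := by omega
    simp [gaussBinom, qPochhammer]
  | succ M ih =>
    cases k with
    | zero =>
      obtain rfl : l = M + 1 := by omega
      simp [gaussBinom, qPochhammer]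
    | succ k =>
      have h1 := ih k l (by omega)
      rw [gaussBinom, qPochhammer_succ, qPochhammer_succ]
      cases l with
      | zero =>
        obtain rfl : k = M := by omega
        rw [gaussBinom_eq_zero q (Nat.lt_succ_self k)]
        linear_combination (1 - q ^ (k + 1)) * h1
      | succ l =>
        have h2 := ih (k + 1) l (by omega)
        obtain rfl : M = k + l + 1 := by omega
        rw [qPochhammer_succ q l] at h1 ⊢
        rw [show k + l + 1 + 1 = (k + 1) + (l + 1) by ring, pow_add q (k + 1) (l + 1)]
        rw [qPochhammer_succ q k] at h2
        linear_combination (1 - q ^ (k + 1)) * h1 + q ^ (k + 1) * (1 - q ^ (l + 1)) * h2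

/-- Rothe's identity, the finite form of the `q`-binomial theorem. -/
theorem prod_one_add_odd_pow_mul (r : ℝ) (M : ℕ) (z : ℝ) :
    ∏ m ∈ Finset.range M, (1 + r ^ (2 * m + 1) * z) =
      ∑ k ∈ Finset.range (M + 1), gaussBinom (r ^ 2) M k * r ^ (k ^ 2) * z ^ k := by
  induction M generalizing z with
  | zero => simp [gaussBinom]
  | succ M ih =>
    have e : ∏ m ∈ Finset.range M, (1 + r ^ (2 * (m + 1) + 1) * z) =
        ∏ m ∈ Finset.range M, (1 + r ^ (2 * m + 1) * (r ^ 2 * z)) :=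
      Finset.prod_congr rfl fun m _ => by ring
    rw [Finset.prod_range_succ', e, ih (r ^ 2 * z), Finset.sum_range_succ' _ (M + 1)]
    have e2 : ∀ k ∈ Finset.range (M + 1),
        gaussBinom (r ^ 2) (M + 1) (k + 1) * r ^ ((k + 1) ^ 2) * z ^ (k + 1) =
        gaussBinom (r ^ 2) M k * r ^ (k ^ 2) * (r ^ 2 * z) ^ k * (r * z) +
        gaussBinom (r ^ 2) M (k + 1) * r ^ ((k + 1) ^ 2) * (r ^ 2 * z) ^ (k + 1) := by
      intro k _
      rw [gaussBinom, show (k + 1) ^ 2 = k ^ 2 + 2 * k + 1 by ring, mul_pow, mul_pow, ← pow_mul,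
        ← pow_mul]
      ring
    rw [Finset.sum_congr rfl e2, Finset.sum_add_distrib, ← Finset.sum_mul]
    have e3 := Finset.sum_range_succ'
      (fun k => gaussBinom (r ^ 2) M k * r ^ (k ^ 2) * (r ^ 2 * z) ^ k) (M + 1)
    rw [Finset.sum_range_succ, gaussBinom_eq_zero _ (Nat.lt_succ_self M)] at e3
    simp only [gaussBinom_zero_right] at e3 ⊢
    linear_combination e3

theorem prod_odd_pow (r : ℝ) (N : ℕ) : ∏ m ∈ Finset.range N, r ^ (2 * m + 1) = r ^ (N ^ 2) := by
  induction N with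
  | zero => simp
  | succ N ih => rw [Finset.prod_range_succ, ih, ← pow_add]; congr 1; ring

/-- The partial products of Jacobi's triple product, without the `q`-Pochhammer factor. -/
noncomputable def jacobiProd (r w : ℝ) (N : ℕ) : ℝ :=
  ∏ m ∈ Finset.range N, ((1 + r ^ (2 * m + 1) * w) * (1 + r ^ (2 * m + 1) / w))

/-- With `z = w / r ^ (2 N)`, the upper half of a Rothe product of length `2 N` gives the factors in
`w`. In the lower half, pulling `w / r ^ (2 m + 1)` out of each factor leaves those in `1 / w`. -/
theorem jacobiProd_mul {r w : ℝ} (hr : r ≠ 0) (hw : w ≠ 0) (N : ℕ) :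
    jacobiProd r w N * w ^ N =
      r ^ (N ^ 2) * ∏ m ∈ Finset.range (N + N), (1 + r ^ (2 * m + 1) * (w / r ^ (2 * N))) := by
  rw [Finset.prod_range_add, ← Finset.prod_range_reflect, ← prod_odd_pow, ← mul_assoc,
    ← Finset.prod_mul_distrib, ← Finset.prod_mul_distrib, jacobiProd,
    show w ^ N = ∏ m ∈ Finset.range N, w by simp, ← Finset.prod_mul_distrib]
  refine Finset.prod_congr rfl fun m hm => ?_
  have hm' : m < N := Finset.mem_range.1 hm
  have e : r ^ (2 * N) = r ^ (2 * (N - 1 - m) + 1) * r ^ (2 * m + 1) := by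
    rw [← pow_add]; congr 1; omega
  have e2 : r ^ (2 * (N + m) + 1) = r ^ (2 * N) * r ^ (2 * m + 1) := by
    rw [← pow_add]; congr 1; ring
  rw [e2, mul_div_assoc', mul_div_assoc', mul_assoc (r ^ (2 * N)),
    mul_div_cancel_left₀ _ (pow_ne_zero _ hr), e, mul_div_mul_left _ _ (pow_ne_zero _ hr)]
  field_simp
  ring

/-- The coefficients of the partial products of Jacobi's triple product. -/
noncomputable def jacobiCoeff (q : ℝ) (N : ℕ) (n : ℤ) : ℝ :=
  if -(N : ℤ) ≤ n then gaussBinom q (N + N) (n + N).toNat else 0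

theorem jacobiProd_eq_tsum {r w : ℝ} (hr : r ≠ 0) (hw : w ≠ 0) (N : ℕ) :
    jacobiProd r w N = ∑' n : ℤ, jacobiCoeff (r ^ 2) N n * (r ^ (n ^ 2) * w ^ n) := by
  have hinj : Function.Injective fun k : ℕ => (k : ℤ) - N := fun a b h => by
    simpa using h
  rw [tsum_eq_sum (s := (Finset.range (N + N + 1)).image fun k : ℕ => (k : ℤ) - N),
    Finset.sum_image hinj.injOn]
  · apply mul_right_cancel₀ (pow_ne_zero N hw)
    rw [jacobiProd_mul hr hw, prod_one_add_odd_pow_mul, Finset.mul_sum, Finset.sum_mul]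
    refine Finset.sum_congr rfl fun k _ => ?_
    rw [jacobiCoeff, if_pos (by omega), show ((k : ℤ) - N + N).toNat = k by omega]
    have e1 : r ^ (N ^ 2) * r ^ (k ^ 2) = r ^ (((k : ℤ) - N) ^ 2) * (r ^ (2 * N)) ^ k := by
      rw [← pow_add, ← pow_mul, ← zpow_natCast, ← zpow_natCast, ← zpow_add₀ hr]
      congr 1
      push_cast
      ring
    have e2 : w ^ ((k : ℤ) - N) * w ^ N = w ^ k := by
      rw [zpow_sub₀ hw, zpow_natCast, zpow_natCast, div_mul_cancel₀ _ (pow_ne_zero _ hw)]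
    rw [div_pow, mul_div_assoc', mul_div_assoc', div_eq_iff (pow_ne_zero _ (pow_ne_zero _ hr))]
    linear_combination gaussBinom (r ^ 2) (N + N) k * (w ^ k * e1 -
      r ^ (((k : ℤ) - N) ^ 2) * (r ^ (2 * N)) ^ k * e2)
  · intro n hn
    rw [jacobiCoeff]
    split_ifs with h
    · rw [gaussBinom_eq_zero, zero_mul]
      by_contra h'
      refine hn (Finset.mem_image.2 ⟨(n + N).toNat, Finset.mem_range.2 (by omega), by omega⟩)
    · simp

/-- From `1 / (1 - t) ≤ exp (t / (1 - t))` and a geometric series. Independence of `N` makes the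
limit of the symbols strictly positive. -/
theorem exp_le_qPochhammer {q : ℝ} (hq : 0 < q) (hq1 : q < 1) (N : ℕ) :
    Real.exp (-(1 / (1 - q)) * (1 / (1 - q))) ≤ qPochhammer q N := by
  have h1 : 0 < 1 - q := sub_pos.2 hq1
  have hs : ∑ m ∈ Finset.range N, q ^ m ≤ 1 / (1 - q) := by
    rw [one_div, ← tsum_geometric_of_lt_one hq.le hq1]
    exact (summable_geometric_of_lt_one hq.le hq1).sum_le_tsum _ fun _ _ => by positivity
  calc Real.exp (-(1 / (1 - q)) * (1 / (1 - q)))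
      ≤ Real.exp (∑ m ∈ Finset.range N, (-(1 / (1 - q)) * q ^ m)) := by
        rw [← Finset.mul_sum]
        refine Real.exp_le_exp.2 ?_
        rw [neg_mul, neg_mul]
        exact neg_le_neg (mul_le_mul_of_nonneg_left hs (by positivity))
    _ = ∏ m ∈ Finset.range N, Real.exp (-(1 / (1 - q)) * q ^ m) := Real.exp_sum _ _
    _ ≤ qPochhammer q N := by
        refine Finset.prod_le_prod (fun _ _ => (Real.exp_pos _).le) fun m _ => ?_
        have hm : q ^ (m + 1) ≤ q := pow_le_of_le_one hq.le hq1.le (Nat.succ_ne_zero m)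
        have hm0 : 0 < 1 - q ^ (m + 1) := by linarith
        have hm2 : q ^ (m + 1) ≤ q ^ m := pow_le_pow_of_le_one hq.le hq1.le (Nat.le_succ m)
        have h2 : q ^ (m + 1) / (1 - q ^ (m + 1)) ≤ 1 / (1 - q) * q ^ m := by
          rw [one_div_mul_eq_div]
          exact div_le_div₀ (by positivity) hm2 h1 (by linarith)
        have h3 := Real.add_one_le_exp (q ^ (m + 1) / (1 - q ^ (m + 1)))
        rw [div_add_one hm0.ne', add_sub_cancel, one_div] at h3
        rw [neg_mul, Real.exp_neg]
        exact (inv_le_comm₀ (Real.exp_pos _) hm0).2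
          (h3.trans (Real.exp_le_exp.2 h2))

theorem qPochhammer_pos {q : ℝ} (hq : 0 < q) (hq1 : q < 1) (N : ℕ) : 0 < qPochhammer q N :=
  (Real.exp_pos _).trans_le (exp_le_qPochhammer hq hq1 N)

theorem qPochhammer_antitone {q : ℝ} (hq : 0 < q) (hq1 : q < 1) : Antitone (qPochhammer q) :=
  antitone_nat_of_succ_le fun N => by
    rw [qPochhammer_succ]
    exact mul_le_of_le_one_right (qPochhammer_pos hq hq1 N).le
      (sub_le_self _ (by positivity))

theorem exists_tendsto_qPochhammer {q : ℝ} (hq : 0 < q) (hq1 : q < 1) :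
    ∃ G, 0 < G ∧ (∀ N, G ≤ qPochhammer q N) ∧
      Filter.Tendsto (qPochhammer q) Filter.atTop (nhds G) := by
  have hb : BddBelow (Set.range (qPochhammer q)) :=
    ⟨0, by rintro _ ⟨N, rfl⟩; exact (qPochhammer_pos hq hq1 N).le⟩
  exact ⟨⨅ N, qPochhammer q N,
    (Real.exp_pos _).trans_le (le_ciInf (exp_le_qPochhammer hq hq1)), ciInf_le hb,
    tendsto_atTop_ciInf (qPochhammer_antitone hq hq1) hb⟩

/-- Jacobi's triple product. -/
theorem exists_tendsto_jacobiProd {r : ℝ} (hr : 0 < r) (hr1 : r < 1) :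
    ∃ c : ℝ, 0 < c ∧ ∀ w : ℝ, w ≠ 0 →
      Filter.Tendsto (jacobiProd r w) Filter.atTop (nhds (c * thetaSeries r w)) := by
  have hq : 0 < r ^ 2 := by positivity
  have hq1 : r ^ 2 < 1 := pow_lt_one₀ hr.le hr1 two_ne_zero
  obtain ⟨G, hG, hle, hlim⟩ := exists_tendsto_qPochhammer hq hq1
  have hpos := qPochhammer_pos hq hq1
  refine ⟨1 / G, by positivity, fun w hw => ?_⟩
  rw [thetaSeries, ← tsum_mul_left]
  simp_rw [funext (jacobiProd_eq_tsum hr.ne' hw)]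
  -- For fixed `n` the coefficient is a quotient of three Pochhammer symbols whose indices all tend
  -- to infinity, so its limit is `G / (G * G)`; it never exceeds `1 / G`.
  refine tendsto_tsum_of_dominated_convergence
    (bound := fun n : ℤ => 1 / G * |r ^ (n ^ 2) * w ^ n|)
    ((summable_abs_theta hr hr1 hw).mul_left _) (fun n => ?_) (Filter.Eventually.of_forall
      fun N n => ?_)
  · refine Filter.Tendsto.mul_const _ ?_
    have ha : Filter.Tendsto (fun N : ℕ => (n + N).toNat) Filter.atTop Filter.atTop :=
      Filter.tendsto_atTop.2 fun b => by
        filter_upwards [Filter.eventually_ge_atTop (b + n.natAbs)] with N hN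
        omega
    have hb : Filter.Tendsto (fun N : ℕ => (N - n : ℤ).toNat) Filter.atTop Filter.atTop :=
      Filter.tendsto_atTop.2 fun b => by
        filter_upwards [Filter.eventually_ge_atTop (b + n.natAbs)] with N hN
        omega
    have hc : Filter.Tendsto (fun N : ℕ => N + N) Filter.atTop Filter.atTop :=
      Filter.tendsto_atTop.2 fun b => by
        filter_upwards [Filter.eventually_ge_atTop b] with N hN
        omega
    have h := (hlim.comp hc).div ((hlim.comp ha).mul (hlim.comp hb)) (by positivity)
    rw [show G / (G * G) = 1 / G by field_simp] at h
    refine h.congr' ?_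
    filter_upwards [Filter.eventually_ge_atTop n.natAbs] with N hN
    have e : N + N = (n + N).toNat + (N - n : ℤ).toNat := by omega
    have h2 := gaussBinom_mul_qPochhammer (r ^ 2) (n + N).toNat (N - n : ℤ).toNat
    rw [← e] at h2
    rw [jacobiCoeff, if_pos (by omega)]
    exact (eq_div_of_mul_eq (mul_pos (hpos _) (hpos _)).ne' h2).symm
  · rw [Real.norm_eq_abs, abs_mul]
    refine mul_le_mul_of_nonneg_right ?_ (abs_nonneg _)
    rw [jacobiCoeff]
    split_ifs with h
    · rw [abs_of_nonneg (gaussBinom_nonneg hq.le _ _)]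
      rcases lt_or_ge (N + N) (n + N).toNat with h' | h'
      · rw [gaussBinom_eq_zero _ h']
        positivity
      · obtain ⟨l, hl⟩ := Nat.exists_eq_add_of_le h'
        have h2 := gaussBinom_mul_qPochhammer (r ^ 2) (n + N).toNat l
        rw [← hl] at h2
        rw [le_div_iff₀ hG]
        have h3 : qPochhammer (r ^ 2) (N + N) ≤ qPochhammer (r ^ 2) (n + N).toNat :=
          qPochhammer_antitone hq hq1 h'
        rw [← h2] at h3
        have h4 : gaussBinom (r ^ 2) (N + N) (n + N).toNat * qPochhammer (r ^ 2) l ≤ 1 := by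
          refine le_of_mul_le_mul_right ?_ (hpos (n + N).toNat)
          linarith
        exact (mul_le_mul_of_nonneg_left (hle l) (gaussBinom_nonneg hq.le _ _)).trans h4
    · rw [abs_zero]
      positivity

/-! ### Multisection of theta products. -/

/-- Cuts the range into blocks of length `2 k` and folds each block about its midpoint, matching the
arguments `w * g ^ (2 j + 1)` and `w / g ^ (2 j + 1)`. -/
theorem prod_range_two_mul_mul {M : Type*} [CommMonoid M] (f : ℕ → M) (k N : ℕ) :
    ∏ l ∈ Finset.range (2 * k * N), f l =
      ∏ m ∈ Finset.range N, ∏ j ∈ Finset.range k,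
        (f (2 * k * m + k + j) * f (2 * k * m + (k - 1 - j))) := by
  induction N with
  | zero => simp
  | succ N ih =>
    rw [Finset.prod_range_succ, ← ih, show 2 * k * (N + 1) = 2 * k * N + (k + k) by ring,
      Finset.prod_range_add, Finset.prod_range_add, Finset.prod_mul_distrib,
      Finset.prod_range_reflect (fun j => f (2 * k * N + j)),
      mul_comm (∏ x ∈ Finset.range k, f (2 * k * N + x))]
    simp only [add_assoc]

/-- Multisection: the theta products at `2 * k` geometrically equidistributed arguments combine
into a single theta product. -/
theorem prod_jacobiProd {g w : ℝ} (hg : g ≠ 0) (hw : w ≠ 0) (k N : ℕ) :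
    ∏ j ∈ Finset.range k, (jacobiProd (g ^ (2 * k)) (w * g ^ (2 * j + 1)) N *
      jacobiProd (g ^ (2 * k)) (w / g ^ (2 * j + 1)) N) = jacobiProd g w (2 * k * N) := by
  rw [jacobiProd, prod_range_two_mul_mul]
  simp only [jacobiProd, ← Finset.prod_mul_distrib]
  rw [Finset.prod_comm]
  refine Finset.prod_congr rfl fun m _ => Finset.prod_congr rfl fun j hj => ?_
  have hj' : j < k := Finset.mem_range.1 hj
  have hv : g ^ (2 * j + 1) ≠ 0 := pow_ne_zero _ hg
  have e1 : g ^ (2 * (2 * k * m + k + j) + 1) =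
      (g ^ (2 * k)) ^ (2 * m + 1) * g ^ (2 * j + 1) := by
    rw [← pow_mul, ← pow_add]; congr 1; ring
  have e2 : g ^ (2 * (2 * k * m + (k - 1 - j)) + 1) * g ^ (2 * j + 1) =
      (g ^ (2 * k)) ^ (2 * m + 1) := by
    rw [← pow_mul, ← pow_add]; congr 1
    have : k - 1 - j + j + 1 = k := by omega
    linear_combination 2 * this
  rw [e1, ← e2]
  field_simp

/-- Multisection for theta series, with a factor that does not depend on the argument. -/
theorem exists_prod_thetaSeries {g : ℝ} (hg : 0 < g) (hg1 : g < 1) {k : ℕ} (hk : k ≠ 0) :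
    ∃ c : ℝ, 0 < c ∧ ∀ w : ℝ, w ≠ 0 →
      ∏ j ∈ Finset.range k, (thetaSeries (g ^ (2 * k)) (w * g ^ (2 * j + 1)) *
        thetaSeries (g ^ (2 * k)) (w / g ^ (2 * j + 1))) = c * thetaSeries g w := by
  obtain ⟨c, hc, h⟩ := exists_tendsto_jacobiProd hg hg1
  obtain ⟨d, hd, h'⟩ := exists_tendsto_jacobiProd (r := g ^ (2 * k)) (by positivity)
    (pow_lt_one₀ hg.le hg1 (by omega))
  -- Each of the `2 k` theta factors on the left carries one triple product constant `d`.
  refine ⟨c / (d * d) ^ k, by positivity, fun w hw => ?_⟩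
  have hv : ∀ j, g ^ (2 * j + 1) ≠ 0 := fun j => by positivity
  have t1 := tendsto_finsetProd (Finset.range k) fun j _ =>
    (h' _ (mul_ne_zero hw (hv j))).mul (h' _ (div_ne_zero hw (hv j)))
  have t2 : Filter.Tendsto (fun N => jacobiProd g w (2 * k * N)) Filter.atTop
      (nhds (c * thetaSeries g w)) :=
    (h w hw).comp (Filter.tendsto_id.const_mul_atTop' (by omega))
  have e := tendsto_nhds_unique (t1.congr fun N => prod_jacobiProd hg.ne' hw k N) t2
  simp only [mul_mul_mul_comm d] at e
  rw [Finset.prod_mul_distrib] at e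
  simp only [Finset.prod_const, Finset.card_range] at e
  rw [div_mul_eq_mul_div, eq_div_iff (by positivity), ← e, mul_comm]

/-! ### Poisson summation and estimates at the dual nome. -/

theorem ofReal_thetaSeries_exp {a : ℝ} (β : ℝ) (ha : 0 < a) :
    (thetaSeries (Real.exp (-Real.pi * a)) (Real.exp (2 * Real.pi * β)) : ℂ) =
      1 / (a : ℂ) ^ (1 / 2 : ℂ) * Complex.exp (Real.pi * β ^ 2 / a) *
        ∑' n : ℤ, (Real.exp (-Real.pi / a * n ^ 2) : ℂ) *
          Complex.exp ((-2 * Real.pi * n * β / a : ℝ) * Complex.I) := by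
  have h := Complex.tsum_exp_neg_quadratic (a := (a : ℂ)) (by simpa using ha) β
  have ha' : (a : ℂ) ≠ 0 := by exact_mod_cast ha.ne'
  rw [thetaSeries, Complex.ofReal_tsum]
  refine (tsum_congr fun n => ?_).trans (h.trans ?_)
  · rw [Complex.ofReal_mul, Complex.ofReal_zpow, Complex.ofReal_zpow, Complex.ofReal_exp,
      Complex.ofReal_exp, ← Complex.exp_int_mul, ← Complex.exp_int_mul, ← Complex.exp_add]
    congr 1
    push_cast
    ring
  · rw [mul_assoc]
    refine congrArg _ (Eq.trans (tsum_congr fun n => ?_) tsum_mul_left)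
    rw [Complex.ofReal_exp, ← Complex.exp_add, ← Complex.exp_add]
    congr 1
    push_cast
    field_simp
    ring_nf
    rw [Complex.I_sq]
    ring

/-- The sign `(-1) ^ n` is an imaginary shift of `β` by `-I / 2`, which moves the dual sum to
half-integers. The prefactor is the same as for positive argument, so it drops out of the ratio. -/
theorem ofReal_thetaSeries_neg_exp {a : ℝ} (β : ℝ) (ha : 0 < a) :
    (thetaSeries (Real.exp (-Real.pi * a)) (-Real.exp (2 * Real.pi * β)) : ℂ) =
      1 / (a : ℂ) ^ (1 / 2 : ℂ) * Complex.exp (Real.pi * β ^ 2 / a) *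
        ∑' n : ℤ, (Real.exp (-Real.pi / a * (n + 1 / 2) ^ 2) : ℂ) *
          Complex.exp ((-2 * Real.pi * (n + 1 / 2) * β / a : ℝ) * Complex.I) := by
  have h := Complex.tsum_exp_neg_quadratic (a := (a : ℂ)) (by simpa using ha) (β - Complex.I / 2)
  have ha' : (a : ℂ) ≠ 0 := by exact_mod_cast ha.ne'
  rw [thetaSeries, Complex.ofReal_tsum]
  refine (tsum_congr fun n => ?_).trans (h.trans ?_)
  · rw [neg_eq_neg_one_mul (Real.exp _), mul_zpow, Complex.ofReal_mul, Complex.ofReal_mul,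
      Complex.ofReal_zpow, Complex.ofReal_zpow, Complex.ofReal_zpow, Complex.ofReal_exp,
      Complex.ofReal_exp, Complex.ofReal_neg, Complex.ofReal_one, ← inv_neg_one,
      ← Complex.exp_pi_mul_I, ← Complex.exp_neg, ← Complex.exp_int_mul, ← Complex.exp_int_mul,
      ← Complex.exp_int_mul, ← Complex.exp_add, ← Complex.exp_add]
    congr 1
    push_cast
    ring
  · rw [mul_assoc]
    refine congrArg _ (Eq.trans (tsum_congr fun n => ?_) tsum_mul_left)
    rw [Complex.ofReal_exp, ← Complex.exp_add, ← Complex.exp_add]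
    congr 1
    push_cast
    field_simp
    ring_nf
    simp only [Complex.I_sq, Complex.I_pow_three, Complex.I_pow_four]
    ring

theorem norm_ofReal_mul_exp_mul_I {x : ℝ} (hx : 0 ≤ x) (y : ℝ) :
    ‖(x : ℂ) * Complex.exp (y * Complex.I)‖ = x := by
  rw [norm_mul, Complex.norm_exp_ofReal_mul_I, mul_one, Complex.norm_of_nonneg hx]

theorem norm_tsum_nat_le_geometric {f : ℕ → ℂ} {C Q : ℝ} (hQ : 0 ≤ Q) (hQ1 : Q < 1)
    (hf : ∀ n, ‖f n‖ ≤ C * Q ^ n) : Summable f ∧ ‖∑' n, f n‖ ≤ C / (1 - Q) := by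
  have h := (hasSum_geometric_of_lt_one hQ hQ1).mul_left C
  exact ⟨h.summable.of_norm_bounded hf, tsum_of_norm_bounded h hf⟩

theorem exp_ofReal_mul_I_add_exp_neg (φ : ℝ) :
    Complex.exp (φ * Complex.I) + Complex.exp ((-φ : ℝ) * Complex.I) = (2 * Real.cos φ : ℝ) := by
  push_cast
  rw [Complex.two_cos]

/-- The indices `0` and `-1` give the cosine; each remaining half is dominated by a geometric series
starting at `Q ^ 2`. -/
theorem norm_exp_half_int_theta_le {a φ : ℝ} (ha : 0 < a) :
    ‖∑' n : ℤ, (Real.exp (-Real.pi / a * (n + 1 / 2) ^ 2) : ℂ) *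
        Complex.exp ((2 * (n + 1 / 2) * φ : ℝ) * Complex.I)‖ ≤
      2 * Real.exp (-Real.pi / a / 4) *
        (|Real.cos φ| + Real.exp (-Real.pi / a) ^ 2 / (1 - Real.exp (-Real.pi / a))) := by
  set Q := Real.exp (-Real.pi / a) with hQ
  set s := Real.exp (-Real.pi / a / 4) with hs
  have hQ0 : 0 < Q := Real.exp_pos _
  have hs0 : 0 < s := Real.exp_pos _
  have hQ1 : Q < 1 := Real.exp_lt_one_iff.2 (div_neg_of_neg_of_pos (neg_neg_of_pos Real.pi_pos) ha)
  set f : ℤ → ℂ := fun n => (Real.exp (-Real.pi / a * (n + 1 / 2) ^ 2) : ℂ) *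
        Complex.exp ((2 * (n + 1 / 2) * φ : ℝ) * Complex.I) with hf
  have hval : ∀ n : ℕ, Real.exp (-Real.pi / a * (n + 1 / 2) ^ 2) = s * Q ^ (n ^ 2 + n) := by
    intro n
    rw [hs, hQ, ← Real.exp_nat_mul, ← Real.exp_add]
    congr 1
    push_cast
    ring
  have h1 : ∀ n : ℕ, ‖f n‖ = s * Q ^ (n ^ 2 + n) := fun n => by
    simp only [hf]
    rw [norm_ofReal_mul_exp_mul_I (Real.exp_pos _).le, ← hval]
    simp
  have h2 : ∀ n : ℕ, ‖f (-(n + 1))‖ = s * Q ^ (n ^ 2 + n) := fun n => by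
    simp only [hf]
    rw [norm_ofReal_mul_exp_mul_I (Real.exp_pos _).le, ← hval]
    congr 2
    push_cast
    ring
  have hle : ∀ n : ℕ, s * Q ^ (n ^ 2 + n) ≤ s * Q ^ n := fun n =>
    mul_le_mul_of_nonneg_left (pow_le_pow_of_le_one hQ0.le hQ1.le (Nat.le_add_left _ _)) hs0.le
  have hle2 : ∀ n : ℕ, s * Q ^ ((n + 1) ^ 2 + (n + 1)) ≤ s * Q ^ 2 * Q ^ n := fun n => by
    rw [mul_assoc, ← pow_add]
    exact mul_le_mul_of_nonneg_left (pow_le_pow_of_le_one hQ0.le hQ1.le (by nlinarith)) hs0.le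
  have S1 := norm_tsum_nat_le_geometric hQ0.le hQ1 fun n => (h1 n).trans_le (hle n)
  have S2 := norm_tsum_nat_le_geometric hQ0.le hQ1 fun n => (h2 n).trans_le (hle n)
  have T1 := norm_tsum_nat_le_geometric hQ0.le hQ1 fun n => (h1 (n + 1)).trans_le (hle2 n)
  have T2 := norm_tsum_nat_le_geometric hQ0.le hQ1 fun n => (h2 (n + 1)).trans_le (hle2 n)
  rw [tsum_of_nat_of_neg_add_one S1.1 S2.1, S1.1.tsum_eq_zero_add, S2.1.tsum_eq_zero_add]
  have h0 : f ((0 : ℕ) : ℤ) + f (-(((0 : ℕ) : ℤ) + 1)) = (2 * s * Real.cos φ : ℝ) := by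
    simp only [hf]
    have e := exp_ofReal_mul_I_add_exp_neg φ
    have e1 : ((((0 : ℕ) : ℤ) : ℝ) + 1 / 2) = 1 / 2 := by norm_num
    have e2 : (((-(((0 : ℕ) : ℤ) + 1) : ℤ) : ℝ) + 1 / 2) = -(1 / 2) := by norm_num
    have e3 : Real.exp (-Real.pi / a * (1 / 2) ^ 2) = s := by rw [hs]; congr 1; ring
    rw [e1, e2, neg_sq, e3, ← mul_add, show 2 * (1 / 2) * φ = φ by ring,
      show 2 * -(1 / 2) * φ = -φ by ring, e]
    push_cast
    ring
  rw [add_add_add_comm, h0]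
  refine (norm_add_le _ _).trans ?_
  have hn : ‖((2 * s * Real.cos φ : ℝ) : ℂ)‖ = 2 * s * |Real.cos φ| := by
    rw [Complex.norm_real, Real.norm_eq_abs, abs_mul, abs_of_pos (by positivity)]
  rw [hn]
  have := (norm_add_le _ _).trans (add_le_add T1.2 T2.2)
  refine (add_le_add_right this _).trans (le_of_eq ?_)
  ring

/-- The indices `0` and `±1` give the main term; each tail is dominated by a geometric series
starting at `Q ^ 4`. -/
theorem le_norm_exp_int_theta {a φ : ℝ} (ha : 0 < a) :
    1 + 2 * Real.exp (-Real.pi / a) * Real.cos (2 * φ) -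
        2 * Real.exp (-Real.pi / a) ^ 4 / (1 - Real.exp (-Real.pi / a)) ≤
      ‖∑' n : ℤ, (Real.exp (-Real.pi / a * n ^ 2) : ℂ) *
        Complex.exp ((2 * n * φ : ℝ) * Complex.I)‖ := by
  set Q := Real.exp (-Real.pi / a) with hQ
  have hQ0 : 0 < Q := Real.exp_pos _
  have hQ1 : Q < 1 := Real.exp_lt_one_iff.2 (div_neg_of_neg_of_pos (neg_neg_of_pos Real.pi_pos) ha)
  set f : ℤ → ℂ := fun n => (Real.exp (-Real.pi / a * n ^ 2) : ℂ) *
        Complex.exp ((2 * n * φ : ℝ) * Complex.I) with hf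
  have hval : ∀ n : ℕ, Real.exp (-Real.pi / a * n ^ 2) = Q ^ (n ^ 2) := by
    intro n
    rw [hQ, ← Real.exp_nat_mul]
    congr 1
    push_cast
    ring
  have h1 : ∀ n : ℕ, ‖f n‖ = Q ^ (n ^ 2) := fun n => by
    simp only [hf]
    rw [norm_ofReal_mul_exp_mul_I (Real.exp_pos _).le, ← hval]
    simp
  have h2 : ∀ n : ℕ, ‖f (-(n + 1))‖ = Q ^ ((n + 1) ^ 2) := fun n => by
    simp only [hf]
    rw [norm_ofReal_mul_exp_mul_I (Real.exp_pos _).le, ← hval]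
    congr 2
    push_cast
    ring
  have hle : ∀ n : ℕ, Q ^ (n ^ 2) ≤ 1 * Q ^ n := fun n => by
    rw [one_mul]
    exact pow_le_pow_of_le_one hQ0.le hQ1.le (by nlinarith)
  have hle1 : ∀ n : ℕ, Q ^ ((n + 1) ^ 2) ≤ 1 * Q ^ n := fun n => by
    rw [one_mul]
    exact pow_le_pow_of_le_one hQ0.le hQ1.le (by nlinarith)
  have hle2 : ∀ n : ℕ, Q ^ ((n + 2) ^ 2) ≤ Q ^ 4 * Q ^ n := fun n => by
    rw [← pow_add]
    exact pow_le_pow_of_le_one hQ0.le hQ1.le (by nlinarith)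
  have S1 := norm_tsum_nat_le_geometric hQ0.le hQ1 fun n => (h1 n).trans_le (hle n)
  have S2 := norm_tsum_nat_le_geometric hQ0.le hQ1 fun n => (h2 n).trans_le (hle1 n)
  have S3 := (summable_nat_add_iff 1).2 S1.1
  have T1 := norm_tsum_nat_le_geometric hQ0.le hQ1 fun n => (h1 (n + 1 + 1)).trans_le (hle2 n)
  have T2 := norm_tsum_nat_le_geometric hQ0.le hQ1 fun n => (h2 (n + 1)).trans_le (hle2 n)
  rw [tsum_of_nat_of_neg_add_one S1.1 S2.1, S1.1.tsum_eq_zero_add, S3.tsum_eq_zero_add,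
    S2.1.tsum_eq_zero_add]
  have h0 : f ((0 : ℕ) : ℤ) + (f ((0 + 1 : ℕ) : ℤ) + f (-(((0 : ℕ) : ℤ) + 1))) =
      (1 + 2 * Q * Real.cos (2 * φ) : ℝ) := by
    simp only [hf]
    have e := exp_ofReal_mul_I_add_exp_neg (2 * φ)
    have e0 : (((0 : ℕ) : ℤ) : ℝ) = 0 := by norm_num
    have e1 : (((0 + 1 : ℕ) : ℤ) : ℝ) = 1 := by norm_num
    have e2 : ((-(((0 : ℕ) : ℤ) + 1) : ℤ) : ℝ) = -1 := by norm_num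
    rw [e0, e1, e2, neg_sq, one_pow, mul_one, ← hQ, ← mul_add, show 2 * 1 * φ = 2 * φ by ring,
      show 2 * -1 * φ = -(2 * φ) by ring, e]
    simp
    ring
  have hn : 1 + 2 * Q * Real.cos (2 * φ) ≤ ‖((1 + 2 * Q * Real.cos (2 * φ) : ℝ) : ℂ)‖ := by
    rw [Complex.norm_real]
    exact le_abs_self _
  have hT := (norm_add_le _ _).trans (add_le_add T1.2 T2.2)
  set A := ∑' n : ℕ, f ((n + 1 + 1 : ℕ) : ℤ)
  set B := ∑' n : ℕ, f (-(((n + 1 : ℕ) : ℤ) + 1))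
  have e : f ((0 : ℕ) : ℤ) + (f ((0 + 1 : ℕ) : ℤ) + A) + (f (-(((0 : ℕ) : ℤ) + 1)) + B) =
      (1 + 2 * Q * Real.cos (2 * φ) : ℝ) + (A + B) := by
    rw [← h0]
    ring
  rw [e]
  have h3 := norm_sub_le (((1 + 2 * Q * Real.cos (2 * φ) : ℝ) : ℂ) + (A + B)) (A + B)
  rw [add_sub_cancel_right] at h3
  have h4 : 2 * Q ^ 4 / (1 - Q) = Q ^ 4 / (1 - Q) + Q ^ 4 / (1 - Q) := by ring
  linarith

/-- Without the tails, the difference of the two sides is `(1 - x) (1 + Q - 4 Q (1 + x)) + Q` with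
`x = |c|`. The product is nonnegative as `7 Q ≤ 1`, and the spare `Q` absorbs tails of at most `0.3
Q + 0.1 Q`. -/
theorem theta_ratio_estimate {Q c : ℝ} (hQ : 0 < Q) (hQ1 : Q ≤ 13 / 100) (hc : |c| ≤ 1) :
    (1 + Q) * (|c| + Q ^ 2 / (1 - Q)) ≤ 1 + 2 * Q * (2 * c ^ 2 - 1) - 2 * Q ^ 4 / (1 - Q) := by
  have h1 : 0 < 1 - Q := by linarith
  rw [← sq_abs c]
  set x := |c|
  have hx : 0 ≤ x := abs_nonneg c
  have hA : Q ^ 2 / (1 - Q) ≤ 3 / 20 * Q := by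
    rw [div_le_iff₀ h1]; nlinarith
  have hB : 2 * Q ^ 4 / (1 - Q) ≤ 1 / 10 * Q := by
    rw [div_le_iff₀ h1]
    have : Q ^ 2 ≤ (13 / 100) ^ 2 := by gcongr
    nlinarith [mul_nonneg hQ.le hQ.le]
  have hC : (1 + Q) * (Q ^ 2 / (1 - Q)) ≤ 2 * (3 / 20 * Q) :=
    mul_le_mul (by linarith) hA (by positivity) (by norm_num)
  have hD : 0 ≤ (1 - x) * (1 + Q - 4 * Q * (1 + x)) :=
    mul_nonneg (by linarith) (by nlinarith)
  nlinarith

/-- The extremal ratio of theta series, bounded through the dual nome. -/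
theorem abs_thetaSeries_neg_mul_le {a w : ℝ} (ha : 0 < a) (hw : 0 < w)
    (hQ : Real.exp (-Real.pi / a) ≤ 13 / 100) :
    |thetaSeries (Real.exp (-Real.pi * a)) (-w)| * (1 + Real.exp (-Real.pi / a)) ≤
      2 * Real.exp (-Real.pi / a / 4) * |thetaSeries (Real.exp (-Real.pi * a)) w| := by
  obtain ⟨β, rfl⟩ : ∃ β, w = Real.exp (2 * Real.pi * β) := ⟨Real.log w / (2 * Real.pi), by
    rw [mul_div_cancel₀ _ (by positivity), Real.exp_log hw]⟩
  set φ := -Real.pi * β / a with hφ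
  rw [← Real.norm_eq_abs, ← Real.norm_eq_abs, ← Complex.norm_real, ← Complex.norm_real,
    ofReal_thetaSeries_exp β ha, ofReal_thetaSeries_neg_exp β ha, norm_mul, norm_mul (_ * _)]
  have e1 : ∀ n : ℤ, -2 * Real.pi * (n : ℝ) * β / a = 2 * n * φ := fun n => by rw [hφ]; ring
  have e2 : ∀ n : ℤ, -2 * Real.pi * ((n : ℝ) + 1 / 2) * β / a = 2 * (n + 1 / 2) * φ :=
    fun n => by rw [hφ]; ring
  simp only [e1, e2]
  have h1 := norm_exp_half_int_theta_le (φ := φ) ha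
  have h2 := le_norm_exp_int_theta (φ := φ) ha
  rw [Real.cos_two_mul] at h2
  have h3 := (theta_ratio_estimate (Real.exp_pos _) hQ (Real.abs_cos_le_one φ)).trans h2
  rw [mul_assoc, mul_left_comm _ ‖_ * _‖]
  refine mul_le_mul_of_nonneg_left ?_ (norm_nonneg _)
  calc _ ≤ _ := mul_le_mul_of_nonneg_right h1 (by positivity)
    _ = 2 * Real.exp (-Real.pi / a / 4) * ((1 + Real.exp (-Real.pi / a)) * (|Real.cos φ| +
        Real.exp (-Real.pi / a) ^ 2 / (1 - Real.exp (-Real.pi / a)))) := by ring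
    _ ≤ _ := mul_le_mul_of_nonneg_left h3 (by positivity)

/-! ### Zolotarev's third problem. -/

/-- Both halves of `o` are compared with the nonnegative half of `e`, hence the factor 2. -/
theorem tsum_int_le_of_nat {e o : ℤ → ℝ} {c : ℝ} (he : Summable e) (ho : Summable o)
    (he0 : ∀ n, 0 ≤ e n) (hc : 0 ≤ c) (h1 : ∀ n : ℕ, o n ≤ c * e n)
    (h2 : ∀ n : ℕ, o (-(n + 1)) ≤ c * e n) : ∑' n, o n ≤ 2 * c * ∑' n, e n := by
  have hi1 : Function.Injective fun n : ℕ => (n : ℤ) := Nat.cast_injective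
  have hi2 : Function.Injective fun n : ℕ => -((n : ℤ) + 1) := fun a b h => by simpa using h
  have E1 : Summable fun n : ℕ => e n := he.comp_injective hi1
  have E2 : Summable fun n : ℕ => e (-(n + 1)) := he.comp_injective hi2
  have O1 : Summable fun n : ℕ => o n := ho.comp_injective hi1
  have O2 : Summable fun n : ℕ => o (-(n + 1)) := ho.comp_injective hi2
  rw [tsum_of_nat_of_neg_add_one O1 O2, tsum_of_nat_of_neg_add_one E1 E2]
  have b1 := O1.tsum_le_tsum h1 (E1.mul_left c)
  have b2 := O2.tsum_le_tsum h2 (E1.mul_left c)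
  rw [tsum_mul_left] at b1 b2
  have b3 : 0 ≤ c * ∑' n : ℕ, e (-(n + 1)) := mul_nonneg hc (tsum_nonneg fun n => he0 _)
  linarith

theorem thetaOdd_one_le {p : ℝ} (hp : 0 < p) (hp1 : p < 1) :
    thetaOdd p 1 ≤ 2 * p * thetaEven p 1 := by
  refine tsum_int_le_of_nat (summable_abs_thetaEven hp hp1 one_ne_zero).of_abs
    (summable_abs_thetaOdd hp hp1 one_ne_zero).of_abs (fun n => by positivity) hp.le
    (fun n => ?_) fun n => ?_
  all_goals
    rw [one_zpow, one_zpow, mul_one, mul_one, ← zpow_one_add₀ hp.ne']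
    refine zpow_le_zpow_right_of_le_one₀ hp hp1.le ?_
    nlinarith [Int.natCast_nonneg n]

/-- Up to scaling, the quotient of the odd and the even theta series is Jacobi's `dn`. -/
theorem exists_thetaOdd_eq_mul_thetaEven {p x : ℝ} (hp : 0 < p) (hp1 : p < 1) (hx : 2 * p ≤ x)
    (hx' : x ≤ 1 / (2 * p)) : ∃ w : ℝ, 0 < w ∧ thetaOdd p w = x * thetaEven p w := by
  have hp2 : 0 < p ^ 2 := by positivity
  have hE1 := thetaEven_pos hp hp1 one_pos
  have hO1 := thetaOdd_pos hp hp1 one_pos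
  have hle := thetaOdd_one_le hp hp1
  have hc : ContinuousOn (fun w => thetaOdd p w / thetaEven p w) (Set.Icc (p ^ 2) 1) :=
    (continuousOn_theta_of_injective hp hp1 injective_two_mul_add_one_int).div
      (continuousOn_theta_of_injective hp hp1 injective_two_mul_int)
      fun w hw => (thetaEven_pos hp hp1 (hp2.trans_le hw.1)).ne'
  have hend : thetaOdd p (p ^ 2) / thetaEven p (p ^ 2) = thetaEven p 1 / thetaOdd p 1 := by
    rw [← thetaOdd_sq_self hp, ← thetaEven_sq_self hp, mul_div_mul_left _ _ hp.ne']
  obtain ⟨w, hw, hwx⟩ := intermediate_value_Icc' (pow_le_one₀ hp.le hp1.le) hc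
    (show x ∈ Set.Icc _ _ from ⟨((div_le_iff₀ hE1).2 hle).trans hx, by
      rw [hend]
      refine hx'.trans ?_
      rw [div_le_div_iff₀ (by positivity) hO1]
      linarith⟩)
  have hw0 := hp2.trans_le hw.1
  exact ⟨w, hw0, (div_eq_iff (thetaEven_pos hp hp1 hw0).ne').1 hwx⟩

/-- Zolotarev's third problem on `[1/√κ, √κ]` and its reflection: an explicit upper bound. -/
theorem exists_zolotarev_bound {κ : ℝ} (hκ : 1 ≤ κ) {k : ℕ} (hk : k ≠ 0) {s : ℝ}
    (hs : s = Real.exp (-(k * Real.pi ^ 2 / (2 * Real.log (4 * κ))))) (hs4 : s ^ 4 ≤ 13 / 100) :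
    ∃ d : ℕ → ℝ, (∀ j, 0 < d j) ∧ ∀ x, 1 / √κ ≤ x → x ≤ √κ →
      |∏ j ∈ Finset.range k, (1 - d j * x)| * (1 + s ^ 4) ≤
        2 * s * ∏ j ∈ Finset.range k, (1 + d j * x) := by
  have hκ0 : 0 < κ := by linarith
  have hk0 : 0 < (k : ℝ) := by exact_mod_cast Nat.pos_of_ne_zero hk
  have hsq : 1 ≤ √κ := Real.one_le_sqrt.2 hκ
  have hπ := Real.pi_pos
  have hL : 0 < Real.log (4 * κ) := Real.log_pos (by linarith)
  -- Chosen so that the guaranteed range `[2 p, 1 / (2 p)]` of the theta quotient is exactly `[1/√κ,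
  -- √κ]`.
  obtain ⟨p, hp⟩ : ∃ p, p = 1 / (2 * √κ) := ⟨_, rfl⟩
  have hp0 : 0 < p := by rw [hp]; positivity
  have hp1 : p < 1 := by rw [hp, div_lt_one (by positivity)]; linarith
  have hp2 : p ^ 2 = 1 / (4 * κ) := by
    rw [hp, div_pow, mul_pow, Real.sq_sqrt hκ0.le]; norm_num
  -- Chosen so that `g ^ (2 * k) = p ^ 2`: the nome required by multisection is the one produced by
  -- the addition formula.
  obtain ⟨a, ha⟩ : ∃ a, a = Real.log (4 * κ) / (2 * k * Real.pi) := ⟨_, rfl⟩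
  have ha0 : 0 < a := by rw [ha]; positivity
  obtain ⟨g, hg⟩ : ∃ g, g = Real.exp (-Real.pi * a) := ⟨_, rfl⟩
  have hg0 : 0 < g := hg ▸ Real.exp_pos _
  have hg1 : g < 1 := by
    rw [hg]; exact Real.exp_lt_one_iff.2 (mul_neg_of_neg_of_pos (neg_neg_of_pos hπ) ha0)
  have hgk : g ^ (2 * k) = p ^ 2 := by
    have e : ((2 * k : ℕ) : ℝ) * (-Real.pi * a) = -Real.log (4 * κ) := by
      rw [ha]
      push_cast
      field_simp
    rw [hg, hp2, ← Real.exp_nat_mul, e, Real.exp_neg, Real.exp_log (by linarith), one_div]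
  have hs' : s = Real.exp (-Real.pi / a / 4) := by
    rw [hs, ha]
    congr 1
    field_simp
    ring
  have hQ : s ^ 4 = Real.exp (-Real.pi / a) := by
    rw [hs', ← Real.exp_nat_mul]
    congr 1
    push_cast
    ring
  obtain ⟨c, hc, hprod⟩ := exists_prod_thetaSeries hg0 hg1 hk
  have hv : ∀ j : ℕ, 0 < g ^ (2 * j + 1) := fun j => by positivity
  have hEv := fun j => thetaEven_pos hp0 hp1 (hv j)
  -- The shifts are values of the theta quotient at the multisection points, so that `1 ± d j * x`
  -- is, up to a positive factor, a product of two theta series at `±w`.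
  refine ⟨fun j => thetaOdd p (g ^ (2 * j + 1)) / thetaEven p (g ^ (2 * j + 1)),
    fun j => div_pos (thetaOdd_pos hp0 hp1 (hv j)) (hEv j), fun x hx1 hx2 => ?_⟩
  obtain ⟨w, hw, hwx⟩ := exists_thetaOdd_eq_mul_thetaEven (x := x) hp0 hp1
    (by rw [hp]; refine le_trans (le_of_eq ?_) hx1; field_simp)
    (by rw [hp]; refine hx2.trans (le_of_eq ?_); field_simp)
  have hEw := thetaEven_pos hp0 hp1 hw
  have hplus := hprod w hw.ne'
  have hminus := hprod (-w) (neg_ne_zero.2 hw.ne')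
  rw [hgk] at hplus hminus
  simp only [fun j => thetaSeries_mul_thetaSeries hp0 hp1 hw.ne' (hv j).ne'] at hplus
  simp only [fun j => thetaSeries_neg_mul_thetaSeries_neg hp0 hp1 hw.ne' (hv j).ne'] at hminus
  have e1 : ∀ j ∈ Finset.range k, thetaEven p w * thetaEven p (g ^ (2 * j + 1)) +
      thetaOdd p w * thetaOdd p (g ^ (2 * j + 1)) =
      (thetaEven p w * thetaEven p (g ^ (2 * j + 1))) *
        (1 + thetaOdd p (g ^ (2 * j + 1)) / thetaEven p (g ^ (2 * j + 1)) * x) := fun j _ => by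
    have := (hEv j).ne'
    rw [hwx]
    field_simp
  have e2 : ∀ j ∈ Finset.range k, thetaEven p w * thetaEven p (g ^ (2 * j + 1)) -
      thetaOdd p w * thetaOdd p (g ^ (2 * j + 1)) =
      (thetaEven p w * thetaEven p (g ^ (2 * j + 1))) *
        (1 - thetaOdd p (g ^ (2 * j + 1)) / thetaEven p (g ^ (2 * j + 1)) * x) := fun j _ => by
    have := (hEv j).ne'
    rw [hwx]
    field_simp
  rw [Finset.prod_congr rfl e1, Finset.prod_mul_distrib] at hplus
  rw [Finset.prod_congr rfl e2, Finset.prod_mul_distrib] at hminus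
  have hA : 0 < ∏ j ∈ Finset.range k, thetaEven p w * thetaEven p (g ^ (2 * j + 1)) :=
    Finset.prod_pos fun j _ => mul_pos hEw (hEv j)
  have hmain := abs_thetaSeries_neg_mul_le ha0 hw (hQ ▸ hs4)
  rw [← hg, ← hQ, ← hs', abs_of_pos (thetaSeries_pos hg0 hg1 hw)] at hmain
  refine le_of_mul_le_mul_left ?_ hA
  rw [← mul_assoc, ← abs_of_pos hA, ← abs_mul, hminus, abs_of_pos hA, mul_left_comm, hplus,
    abs_mul, abs_of_pos hc]
  nlinarith [mul_le_mul_of_nonneg_left hmain hc.le]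

/-! ### Courant–Fischer and alternating direction iteration. -/

section SymmetricOperators

variable {E : Type*} [NormedAddCommGroup E] [InnerProductSpace ℝ E]

theorem LinearMap.IsSymmetric.inner_apply_self_eq_sum [FiniteDimensional ℝ E] {T : E →ₗ[ℝ] E}
    (hT : T.IsSymmetric) {n : ℕ} (hn : Module.finrank ℝ E = n) (x : E) :
    inner ℝ (T x) x =
      ∑ i, hT.eigenvalues hn i * (inner ℝ (hT.eigenvectorBasis hn i) x) ^ 2 := by
  rw [← (hT.eigenvectorBasis hn).sum_inner_mul_inner (T x) x]
  refine Finset.sum_congr rfl fun i _ => ?_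
  rw [hT x, hT.apply_eigenvectorBasis hn i, real_inner_smul_right, real_inner_comm x]
  simp only [RCLike.ofReal_real_eq_id, _root_.id]
  ring

theorem OrthonormalBasis.inner_self_eq_sum {n : ℕ} (b : OrthonormalBasis (Fin n) ℝ E) (x : E) :
    inner ℝ x x = ∑ i, (inner ℝ (b i) x) ^ 2 := by
  rw [← b.sum_inner_mul_inner x x]
  refine Finset.sum_congr rfl fun i _ => ?_
  rw [real_inner_comm x, sq]

/-- The upper bound in the Courant–Fischer principle. -/
theorem LinearMap.IsSymmetric.eigenvalues_le_of_subspace [FiniteDimensional ℝ E]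
    {T : E →ₗ[ℝ] E} (hT : T.IsSymmetric) {n : ℕ} (hn : Module.finrank ℝ E = n) (m : Fin n)
    (W : Submodule ℝ E)
    (hW : n ≤ Module.finrank ℝ W + m) (c : ℝ) (h : ∀ x ∈ W, inner ℝ (T x) x ≤ c * inner ℝ x x) :
    hT.eigenvalues hn m ≤ c := by
  set b := hT.eigenvectorBasis hn with hb
  -- A kernel vector of `L` lies in `W` and in the span of the eigenvectors of index at most `m`; it
  -- exists because `L` has only `n - 1 - m < dim W` coordinates.
  let L : W →ₗ[ℝ] (Finset.Ioi m → ℝ) :=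
    LinearMap.pi fun i => (innerSL ℝ (b i)).toLinearMap ∘ₗ W.subtype
  have hker : LinearMap.ker L ≠ ⊥ := by
    refine LinearMap.ker_ne_bot_of_finrank_lt ?_
    rw [Module.finrank_fintype_fun_eq_card, Fintype.card_coe, Fin.card_Ioi]
    have := m.isLt
    omega
  obtain ⟨⟨x, hxW⟩, hxL, hx0⟩ := Submodule.exists_mem_ne_zero_of_ne_bot hker
  have hx : 0 < inner ℝ x x := real_inner_self_pos.2 fun h0 => hx0 (Subtype.ext h0)
  have hzero : ∀ i, m < i → inner ℝ (b i) x = 0 := fun i hi =>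
    congrFun (LinearMap.mem_ker.1 hxL) ⟨i, Finset.mem_Ioi.2 hi⟩
  refine le_of_mul_le_mul_right ?_ hx
  refine le_trans ?_ (h x hxW)
  rw [hT.inner_apply_self_eq_sum hn, b.inner_self_eq_sum, Finset.mul_sum]
  refine Finset.sum_le_sum fun i _ => ?_
  rcases lt_or_ge m i with hi | hi
  · rw [← hb, hzero i hi]
    simp
  · exact mul_le_mul_of_nonneg_right (hT.eigenvalues_antitone hn hi) (sq_nonneg _)

theorem LinearMap.IsSymmetric.inner_apply_self_le [FiniteDimensional ℝ E] {T : E →ₗ[ℝ] E}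
    (hT : T.IsSymmetric) {n : ℕ} (hn : Module.finrank ℝ E = n) {c : ℝ}
    (hc : ∀ i, hT.eigenvalues hn i ≤ c) (x : E) :
    inner ℝ (T x) x ≤ c * inner ℝ x x := by
  rw [hT.inner_apply_self_eq_sum hn, (hT.eigenvectorBasis hn).inner_self_eq_sum, Finset.mul_sum]
  exact Finset.sum_le_sum fun i _ => mul_le_mul_of_nonneg_right (hc i) (sq_nonneg _)

theorem LinearMap.IsSymmetric.polynomial_aeval {T : E →ₗ[ℝ] E} (hT : T.IsSymmetric)
    (p : Polynomial ℝ) : (Polynomial.aeval T p).IsSymmetric := by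
  induction p using Polynomial.induction_on' with
  | add p q hp hq => rw [map_add]; exact hp.add hq
  | monomial n a =>
    rw [Polynomial.aeval_monomial, ← Algebra.smul_def]
    exact (hT.pow n).smul (by simp)

/-- A pointwise bound between polynomials on the spectrum gives a norm bound. -/
theorem inner_aeval_le_of_eigenbasis {T : E →ₗ[ℝ] E} (hT : T.IsSymmetric) {n : ℕ}
    (b : OrthonormalBasis (Fin n) ℝ E) {μ : Fin n → ℝ} (hb : ∀ i, T (b i) = μ i • b i)
    (p q : Polynomial ℝ) (B : ℝ) (h : ∀ i, p.eval (μ i) ^ 2 ≤ B * q.eval (μ i) ^ 2) (x : E) :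
    inner ℝ (Polynomial.aeval T p x) (Polynomial.aeval T p x) ≤
      B * inner ℝ (Polynomial.aeval T q x) (Polynomial.aeval T q x) := by
  have key : ∀ r : Polynomial ℝ, ∀ i,
      inner ℝ (b i) (Polynomial.aeval T r x) = r.eval (μ i) * inner ℝ (b i) x := fun r i => by
    rw [← hT.polynomial_aeval r, Module.End.aeval_apply_of_hasEigenvector (μ := μ i)
      ⟨Module.End.mem_eigenspace_iff.2 (hb i), b.orthonormal.ne_zero i⟩, real_inner_smul_left]
  rw [b.inner_self_eq_sum, b.inner_self_eq_sum, Finset.mul_sum]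
  refine Finset.sum_le_sum fun i _ => ?_
  rw [key, key, mul_pow, mul_pow, ← mul_assoc]
  exact mul_le_mul_of_nonneg_right (h i) (sq_nonneg _)

/-- The product `∏ ((1 + X) + d j * (1 - X))`. -/
noncomputable def adiPoly (d : ℕ → ℝ) (k : ℕ) : Polynomial ℝ :=
  ∏ j ∈ Finset.range k, ((1 + Polynomial.X) + Polynomial.C (d j) * (1 - Polynomial.X))

theorem rank_smul_le (c : ℝ) (f : E →ₗ[ℝ] E) : (c • f).rank ≤ f.rank := by
  have : c • f = (c • LinearMap.id).comp f := by ext; simp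
  rw [this]
  exact LinearMap.rank_comp_le_right _ _

/-- A Stein equation with a right-hand side of rank `m` survives `k` steps of alternating direction
iteration with right-hand side of rank `m * k`. -/
theorem rank_adi_le (D M : Module.End ℝ E) (m : ℕ) (hM : LinearMap.rank (M - D * M * D) ≤ m)
    (d : ℕ → ℝ) (k : ℕ) :
    LinearMap.rank (Polynomial.aeval D (adiPoly d k) * M * Polynomial.aeval D (adiPoly d k) -
      Polynomial.aeval D (adiPoly (-d) k) * M * Polynomial.aeval D (adiPoly (-d) k)) ≤
      ((m * k : ℕ) : Cardinal) := by
  induction k with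
  | zero =>
    have h0 : adiPoly (-d) 0 = adiPoly d 0 := by simp [adiPoly]
    rw [h0, sub_self, LinearMap.rank_zero]
    exact bot_le
  | succ k ih =>
    set U := Polynomial.aeval D (adiPoly d k)
    set V := Polynomial.aeval D (adiPoly (-d) k)
    have hU : ∀ e : ℕ → ℝ, Polynomial.aeval D (adiPoly e (k + 1)) =
        Polynomial.aeval D (adiPoly e k) * ((1 + D) + e k • (1 - D)) := fun e => by
      rw [adiPoly, Finset.prod_range_succ, map_mul, ← adiPoly]
      simp [Algebra.smul_def]
    have hU' : ∀ e : ℕ → ℝ, Polynomial.aeval D (adiPoly e (k + 1)) =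
        ((1 + D) + e k • (1 - D)) * Polynomial.aeval D (adiPoly e k) := fun e => by
      rw [adiPoly, Finset.prod_range_succ, mul_comm, map_mul, ← adiPoly]
      simp [Algebra.smul_def]
    set G := (1 + D) + d k • (1 - D) with hG
    set H := (1 + D) + (-d) k • (1 - D) with hH
    have hGV : G * V = V * G := by
      have e : G = Polynomial.aeval D
          ((1 + Polynomial.X) + Polynomial.C (d k) * (1 - Polynomial.X)) := by
        simp [hG, Algebra.smul_def]
      rw [e, ← map_mul, ← map_mul, mul_comm]
    -- The terms even in `d k` cancel; the odd ones combine `(1 + D) M (1 - D)` with `(1 - D) M (1 +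
    -- D)`, whose sum is `2 (M - D M D)`.
    have hGH : G * M * G - H * M * H = (4 * d k) • (M - D * M * D) := by
      rw [hG, hH]
      simp only [Pi.neg_apply, neg_smul, add_mul, mul_add, sub_mul, mul_sub, smul_mul_assoc,
        mul_smul_comm, smul_add, smul_sub, one_mul, mul_one, neg_mul, mul_neg, smul_neg]
      module
    -- Adding and subtracting `G V M V G` splits off the previous step; since polynomials in `D`
    -- commute, the rest is one Stein residual between two copies of `V`.
    have e : Polynomial.aeval D (adiPoly d (k + 1)) * M * Polynomial.aeval D (adiPoly d (k + 1)) -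
        Polynomial.aeval D (adiPoly (-d) (k + 1)) * M * Polynomial.aeval D (adiPoly (-d) (k + 1)) =
        G * (U * M * U - V * M * V) * G + V * ((4 * d k) • (M - D * M * D)) * V := by
      rw [← hGH, mul_sub, sub_mul, mul_sub, sub_mul]
      have e1 : G * (V * M * V) * G = V * (G * M * G) * V := by
        calc G * (V * M * V) * G = (G * V) * M * (V * G) := by simp only [mul_assoc]
          _ = (V * G) * M * (G * V) := by rw [hGV]
          _ = _ := by simp only [mul_assoc]
      rw [e1]
      nth_rewrite 1 [hU' d]
      rw [hU d, hU (-d)]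
      nth_rewrite 2 [← hU (-d)]
      rw [hU' (-d)]
      have e2 : G * U * M * (U * G) = G * (U * M * U) * G := by simp only [mul_assoc]
      have e3 : V * H * M * (H * V) = V * (H * M * H) * V := by simp only [mul_assoc]
      rw [e2, e3]
      abel
    rw [e]
    refine (LinearMap.rank_add_le _ _).trans ?_
    rw [Nat.mul_succ, Nat.cast_add]
    refine add_le_add ?_ ?_
    · exact (LinearMap.rank_comp_le_left _ _).trans ((LinearMap.rank_comp_le_right _ _).trans ih)
    · exact (LinearMap.rank_comp_le_left _ _).trans ((LinearMap.rank_comp_le_right _ _).trans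
        ((rank_smul_le _ _).trans hM))

/-- Eigenvalue decay for the solution of a Stein equation with right-hand side of rank `m`. -/
theorem eigenvalues_le_of_stein [FiniteDimensional ℝ E] {D M : Module.End ℝ E}
    (hD : D.IsSymmetric) (hM : M.IsSymmetric) {n : ℕ} (hn : Module.finrank ℝ E = n) {m : ℕ}
    (hrank : LinearMap.rank (M - D * M * D) ≤ m)
    (b : OrthonormalBasis (Fin n) ℝ E) {μ : Fin n → ℝ} (hb : ∀ i, D (b i) = μ i • b i)
    {d : ℕ → ℝ} {k : ℕ} {B c : ℝ} (hc : 0 ≤ c) (hMc : ∀ i, hM.eigenvalues hn i ≤ c)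
    (hB : ∀ i, (adiPoly (-d) k).eval (μ i) ^ 2 ≤ B * (adiPoly d k).eval (μ i) ^ 2)
    (hpos : ∀ i, (adiPoly d k).eval (μ i) ≠ 0) (hk : m * k < n) :
    hM.eigenvalues hn ⟨m * k, hk⟩ ≤ B * c := by
  set U := Polynomial.aeval D (adiPoly d k) with hU
  set V := Polynomial.aeval D (adiPoly (-d) k) with hV
  set Δ := U * M * U - V * M * V
  have hΔ : Module.finrank ℝ (LinearMap.range Δ) ≤ m * k :=
    Module.finrank_le_of_rank_le (rank_adi_le D M m hrank d k)
  have hinj : Function.Injective U := by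
    refine (injective_iff_map_eq_zero U).2 fun x hx => ?_
    have h0 : ∀ i, inner ℝ (b i) x = 0 := fun i => by
      have h1 : inner ℝ (b i) (U x) = (adiPoly d k).eval (μ i) * inner ℝ (b i) x := by
        rw [← hD.polynomial_aeval, Module.End.aeval_apply_of_hasEigenvector (μ := μ i)
          ⟨Module.End.mem_eigenspace_iff.2 (hb i), b.orthonormal.ne_zero i⟩, real_inner_smul_left]
      rw [hx, inner_zero_right] at h1
      exact (mul_eq_zero.1 h1.symm).resolve_left (hpos i)
    refine inner_self_eq_zero (𝕜 := ℝ).1 ?_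
    rw [b.inner_self_eq_sum]
    simp [h0]
  have hUs := hD.polynomial_aeval (adiPoly d k)
  have hVs := hD.polynomial_aeval (adiPoly (-d) k)
  -- The test space `U (ker Δ)` has codimension at most `m * k`, which is the zero-based index of
  -- the eigenvalue.
  refine hM.eigenvalues_le_of_subspace hn _ ((LinearMap.ker Δ).map U) ?_ _ ?_
  · rw [← (Submodule.equivMapOfInjective U hinj (LinearMap.ker Δ)).finrank_eq]
    have := Δ.finrank_range_add_finrank_ker
    simp only
    omega
  · rintro _ ⟨z, hz, rfl⟩
    have hz' : U (M (U z)) = V (M (V z)) := sub_eq_zero.1 (LinearMap.mem_ker.1 hz)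
    calc inner ℝ (M (U z)) (U z) = inner ℝ (U (M (U z))) z := (hUs _ _).symm
      _ = inner ℝ (M (V z)) (V z) := by rw [hz']; exact hVs _ _
      _ ≤ c * inner ℝ (V z) (V z) := hM.inner_apply_self_le hn hMc _
      _ ≤ c * (B * inner ℝ (U z) (U z)) := mul_le_mul_of_nonneg_left
          (inner_aeval_le_of_eigenbasis hD b hb _ _ B hB z) hc
      _ = B * c * inner ℝ (U z) (U z) := by ring

end SymmetricOperators

/-! ### The Stein equation of the target matrix. -/

/-- `T • P_1^y(T)` as a plain sum. -/
theorem smul_targetPCA_eq_sum {n : ℕ} (K : Matrix (Fin n) (Fin n) ℝ) (α : ℝ) (y : Fin n → ℝ)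
    {T : ℕ} (hT : 1 ≤ T) :
    (T : ℝ) • targetPCA K α y T =
      ∑ t ∈ Finset.range T, stepMatrix K α ^ t * Matrix.vecMulVec y y * stepMatrix K α ^ t := by
  rw [targetPCA, smul_smul, mul_one_div_cancel (by positivity), one_smul]

theorem sum_sub_mul_sum_mul {R : Type*} [Ring R] (D Y : R) (T : ℕ) :
    ∑ t ∈ Finset.range T, D ^ t * Y * D ^ t - D * (∑ t ∈ Finset.range T, D ^ t * Y * D ^ t) * D =
      Y - D ^ T * Y * D ^ T := by
  rw [Finset.mul_sum, Finset.sum_mul, ← Finset.sum_sub_distrib]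
  have h := Finset.sum_range_sub' (fun t => D ^ t * Y * D ^ t) T
  rw [pow_zero, one_mul, mul_one] at h
  rw [← h]
  refine Finset.sum_congr rfl fun t _ => ?_
  nth_rewrite 1 [pow_succ' D t]
  rw [pow_succ D t]
  simp only [mul_assoc]

theorem isHermitian_stepMatrix {n : ℕ} {K : Matrix (Fin n) (Fin n) ℝ} (hK : K.IsHermitian)
    (α : ℝ) : (stepMatrix K α).IsHermitian :=
  Matrix.isHermitian_one.sub (hK.smul (IsSelfAdjoint.all α))

theorem posSemidef_smul_targetPCA {n : ℕ} {K : Matrix (Fin n) (Fin n) ℝ} (hK : K.IsHermitian)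
    (α : ℝ) (y : Fin n → ℝ) {T : ℕ} (hT : 1 ≤ T) :
    ((T : ℝ) • targetPCA K α y T).PosSemidef := by
  rw [smul_targetPCA_eq_sum K α y hT]
  refine Matrix.posSemidef_sum _ fun t _ => ?_
  have h := (Matrix.posSemidef_vecMulVec_self_star y).mul_mul_conjTranspose_same
    (stepMatrix K α ^ t)
  rwa [((isHermitian_stepMatrix hK α).pow t).eq, star_trivial] at h

theorem rank_toEuclideanLin_vecMulVec_le {n : ℕ} (y : Fin n → ℝ) :
    LinearMap.rank (Matrix.toEuclideanLin (Matrix.vecMulVec y y)) ≤ 1 := by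
  have h : LinearMap.range (Matrix.toEuclideanLin (Matrix.vecMulVec y y)) ≤
      Submodule.span ℝ {WithLp.toLp 2 y} := by
    rintro _ ⟨x, rfl⟩
    refine Submodule.mem_span_singleton.2 ⟨y ⬝ᵥ WithLp.ofLp x, ?_⟩
    ext j
    simp [Matrix.toLpLin_apply, Matrix.vecMulVec_mulVec, mul_comm]
  refine (Submodule.rank_mono h).trans ((rank_span_le _).trans ?_)
  simp

theorem rank_stein_targetPCA_le {n : ℕ} (K : Matrix (Fin n) (Fin n) ℝ) (α : ℝ) (y : Fin n → ℝ)
    {T : ℕ} (hT : 1 ≤ T) :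
    LinearMap.rank ((Matrix.toEuclideanLin ((T : ℝ) • targetPCA K α y T) : Module.End ℝ _) -
      (Matrix.toEuclideanLin (stepMatrix K α) : Module.End ℝ _) *
        (Matrix.toEuclideanLin ((T : ℝ) • targetPCA K α y T) : Module.End ℝ _) *
        (Matrix.toEuclideanLin (stepMatrix K α) : Module.End ℝ _)) ≤ ((2 : ℕ) : Cardinal) := by
  have e := congrArg Matrix.toEuclideanLin
    (sum_sub_mul_sum_mul (stepMatrix K α) (Matrix.vecMulVec y y) T)
  rw [← smul_targetPCA_eq_sum K α y hT, map_sub, map_sub, Matrix.toLpLin_mul_same,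
    Matrix.toLpLin_mul_same, Matrix.toLpLin_mul_same, Matrix.toLpLin_mul_same] at e
  refine (congrArg LinearMap.rank e).trans_le ?_
  have h1 := rank_toEuclideanLin_vecMulVec_le y
  rw [sub_eq_add_neg, ← neg_one_smul ℝ]
  refine (LinearMap.rank_add_le _ _).trans ?_
  refine (add_le_add h1 ((rank_smul_le _ _).trans ((LinearMap.rank_comp_le_left _ _).trans
    ((LinearMap.rank_comp_le_right _ _).trans h1)))).trans_eq ?_
  norm_num

theorem Matrix.IsHermitian.eigenvalues₀_eq_eigenvalues {n : ℕ} {A : Matrix (Fin n) (Fin n) ℝ}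
    (hA : A.IsHermitian) (i : Fin (Fintype.card (Fin n))) :
    hA.eigenvalues₀ i = hA.eigenvalues (Fintype.equivOfCardEq (Fintype.card_fin _) i) := by
  rw [Matrix.IsHermitian.eigenvalues, Equiv.symm_apply_apply]

/-! ### Cayley transform and conclusion. -/

theorem eval_adiPoly (d : ℕ → ℝ) (k : ℕ) (x : ℝ) :
    (adiPoly d k).eval x = ∏ j ∈ Finset.range k, ((1 + x) + d j * (1 - x)) := by
  simp [adiPoly, Polynomial.eval_prod]

/-- The Cayley transform maps the spectrum of the step matrix into the interval of the Zolotarev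
problem. -/
theorem cayley_mem_interval {α l L x κ : ℝ} (hα : 0 < α) (hl : 0 < l) (hlx : l ≤ x) (hxL : x ≤ L)
    (hαL : α * L < 1) (hκ : κ = 2 * L / l - 1) :
    1 / √κ ≤ (2 - α * l) / (α * l * √κ) * (α * x / (2 - α * x)) ∧
      (2 - α * l) / (α * l * √κ) * (α * x / (2 - α * x)) ≤ √κ := by
  have hx : 0 < x := hl.trans_le hlx
  have hαx : α * x < 1 := (mul_le_mul_of_nonneg_left hxL hα.le).trans_lt hαL
  have hx2 : 0 < 2 - α * x := by linarith
  have hκ1 : 1 ≤ κ := by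
    have : 1 ≤ L / l := (one_le_div hl).2 (hlx.trans hxL)
    rw [hκ, mul_div_assoc]
    linarith
  have hκl : κ * l = 2 * L - l := by rw [hκ]; field_simp
  have hsq : 0 < √κ := Real.sqrt_pos.2 (by linarith)
  have e : (2 - α * l) / (α * l * √κ) * (α * x / (2 - α * x)) =
      (x * (2 - α * l)) / (l * (2 - α * x)) / √κ := by
    field_simp
  rw [e]
  have hd : 0 < l * (2 - α * x) := mul_pos hl hx2
  constructor
  · refine div_le_div_of_nonneg_right ?_ hsq.le
    rw [one_le_div hd]
    nlinarith
  · rw [div_le_iff₀ hsq, Real.mul_self_sqrt (by linarith), div_le_iff₀ hd, ← mul_assoc, hκl]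
    -- The inequality is affine in `x`: `h1` reduces it to `x = L`, where the slack is `2 (L - l) (1
    -- - α L)`. Thus `κ` is the ratio of the transformed endpoints in the limiting case `α L = 1`.
    have h1 : 0 ≤ (L - x) * ((2 - α * l) + (2 * L - l) * α) :=
      mul_nonneg (by linarith) (by nlinarith)
    have h2 : 0 ≤ (L - l) * (1 - α * L) := mul_nonneg (by linarith) (by linarith)
    nlinarith

theorem one_le_two_mul_div {s : ℝ} (hs : 0.6 ≤ s) (hs1 : s ≤ 1) : 1 ≤ 2 * s / (1 + s ^ 4) := by
  rw [one_le_div (by positivity)]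
  -- The product equals `2 s - 1 - s ^ 4`.
  have h1 : 0 ≤ (1 - s) * (s ^ 3 + s ^ 2 + s - 1) := by
    refine mul_nonneg (by linarith) ?_
    have h2 : (0.6 : ℝ) ^ 2 ≤ s ^ 2 := by gcongr
    have h3 : (0.6 : ℝ) ^ 3 ≤ s ^ 3 := by gcongr
    norm_num at h2 h3 hs
    linarith
  nlinarith

/-- The polynomials built from a solution of the Zolotarev problem, compared at a point of the
spectrum of the step matrix. -/
theorem eval_adiPoly_sq_le {α x γ B : ℝ} {d : ℕ → ℝ} {k : ℕ} (hx : α * x < 2)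
    (h : |∏ j ∈ Finset.range k, (1 - d j * (γ * (α * x / (2 - α * x))))| ≤
      B * ∏ j ∈ Finset.range k, (1 + d j * (γ * (α * x / (2 - α * x))))) :
    (adiPoly (-(γ • d)) k).eval (1 - α * x) ^ 2 ≤
      B ^ 2 * (adiPoly (γ • d) k).eval (1 - α * x) ^ 2 := by
  have hx2 : 2 - α * x ≠ 0 := by linarith
  have e1 : (adiPoly (-(γ • d)) k).eval (1 - α * x) =
      (∏ j ∈ Finset.range k, (2 - α * x)) *
        ∏ j ∈ Finset.range k, (1 - d j * (γ * (α * x / (2 - α * x)))) := by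
    rw [eval_adiPoly, ← Finset.prod_mul_distrib]
    refine Finset.prod_congr rfl fun j _ => ?_
    simp only [Pi.neg_apply, Pi.smul_apply, smul_eq_mul]
    field_simp
    ring
  have e2 : (adiPoly (γ • d) k).eval (1 - α * x) =
      (∏ j ∈ Finset.range k, (2 - α * x)) *
        ∏ j ∈ Finset.range k, (1 + d j * (γ * (α * x / (2 - α * x)))) := by
    rw [eval_adiPoly, ← Finset.prod_mul_distrib]
    refine Finset.prod_congr rfl fun j _ => ?_
    simp only [Pi.smul_apply, smul_eq_mul]
    field_simp
    ring
  rw [e1, e2, mul_pow, mul_pow, mul_left_comm]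
  refine mul_le_mul_of_nonneg_left ?_ (sq_nonneg _)
  rw [← mul_pow, ← sq_abs]
  exact pow_le_pow_left₀ (abs_nonneg _) h 2

theorem lemma1 {n : ℕ} (hn : 1 ≤ n) (K : Matrix (Fin n) (Fin n) ℝ) (hK : K.PosDef)
    (α : ℝ) (hα : 0 < α) (hα1 : α < 1 / eigDesc hK.isHermitian 1 le_rfl hn)
    (y : Fin n → ℝ) (hy : y ≠ 0) (T : ℕ) (hT : 1 ≤ T)
    (ρ : ℝ) (hρ : ρ = decayRate (eigDesc hK.isHermitian 1 le_rfl hn)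
      (eigDesc hK.isHermitian n hn le_rfl))
    (i : ℕ) (hi : 1 + 2 * i ≤ n) :
    eigDesc (isHermitian_smul_targetPCA hK.isHermitian α y T) (1 + 2 * i) (by omega) hi /
        eigDesc (isHermitian_smul_targetPCA hK.isHermitian α y T) 1 le_rfl hn
      ≤ 4 * ρ ^ (-(2 * (i : ℤ))) / (1 + ρ ^ (-(4 * (i : ℤ)))) ^ 2 ∧
    4 * ρ ^ (-(2 * (i : ℤ))) / (1 + ρ ^ (-(4 * (i : ℤ)))) ^ 2 < 4 * ρ ^ (-(2 * (i : ℤ))) := by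
  set hM := isHermitian_smul_targetPCA hK.isHermitian α y T
  have hρ0 : 0 < ρ := hρ ▸ Real.exp_pos _
  refine ⟨?_, div_lt_self (by positivity) (one_lt_pow₀ (lt_add_of_pos_right 1 (by positivity))
    two_ne_zero)⟩
  set l₁ := eigDesc hK.isHermitian 1 le_rfl hn with hl₁
  set lₙ := eigDesc hK.isHermitian n hn le_rfl with hlₙ
  have hlₙ0 : 0 < lₙ := by
    rw [hlₙ, eigDesc, Matrix.IsHermitian.eigenvalues₀_eq_eigenvalues]
    exact hK.eigenvalues_pos _
  have hle₁ : ∀ j, hK.isHermitian.eigenvalues₀ j ≤ l₁ := fun j =>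
    hK.isHermitian.eigenvalues₀_antitone (Fin.mk_le_of_le_val (by simp))
  have hleₙ : ∀ j, lₙ ≤ hK.isHermitian.eigenvalues₀ j := fun j =>
    hK.isHermitian.eigenvalues₀_antitone (Fin.le_def.2 (by
      have := j.isLt
      simp only [Fintype.card_fin] at this
      simp only
      omega))
  have hl : lₙ ≤ l₁ := hleₙ _
  have hl₁0 : 0 < l₁ := hlₙ0.trans_le hl
  have hαl : α * l₁ < 1 := (lt_div_iff₀ hl₁0).1 hα1
  set c := eigDesc hM 1 le_rfl hn with hc
  have hc0 : 0 ≤ c := by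
    rw [hc, eigDesc, Matrix.IsHermitian.eigenvalues₀_eq_eigenvalues]
    exact (posSemidef_smul_targetPCA hK.isHermitian α y hT).eigenvalues_nonneg _
  have hMc : ∀ j, hM.eigenvalues₀ j ≤ c := fun j =>
    hM.eigenvalues₀_antitone (Fin.mk_le_of_le_val (by simp))
  obtain ⟨κ, hκ⟩ : ∃ κ, κ = 2 * l₁ / lₙ - 1 := ⟨_, rfl⟩
  have hκ1 : 1 ≤ κ := by
    have : 1 ≤ l₁ / lₙ := (one_le_div hlₙ0).2 hl
    rw [hκ, mul_div_assoc]
    linarith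
  have hL : 0 < Real.log (4 * κ) := Real.log_pos (by linarith)
  obtain ⟨s, hs⟩ : ∃ s, s = Real.exp (-(i * Real.pi ^ 2 / (2 * Real.log (4 * κ)))) := ⟨_, rfl⟩
  have hs0 : 0 < s := hs ▸ Real.exp_pos _
  have hs1 : s ≤ 1 := by
    rw [hs]
    exact Real.exp_le_one_iff.2 (neg_nonpos.2 (by positivity))
  have hρi : ρ ^ (-(i : ℤ)) = s := by
    rw [hρ, decayRate, show 8 * l₁ / lₙ - 4 = 4 * κ by rw [hκ]; ring, zpow_neg, zpow_natCast,
      ← Real.exp_nat_mul, ← Real.exp_neg, hs, mul_div_assoc]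
  have e2 : ρ ^ (-(2 * (i : ℤ))) = s ^ 2 := by
    rw [← hρi, ← zpow_natCast, ← zpow_mul]; congr 1; push_cast; ring
  have e4 : ρ ^ (-(4 * (i : ℤ))) = s ^ 4 := by
    rw [← hρi, ← zpow_natCast, ← zpow_mul]; congr 1; push_cast; ring
  rw [e2, e4, show 4 * s ^ 2 / (1 + s ^ 4) ^ 2 = (2 * s / (1 + s ^ 4)) ^ 2 by
    rw [div_pow, mul_pow]; norm_num]
  -- For `s ≥ 0.6` the bound is at least 1 and hence trivial; this includes `i = 0`, where `s = 1`.
  -- Otherwise `s ^ 4 ≤ 0.6 ^ 4 = 0.1296`, within the range of the theta estimate.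
  rcases le_or_gt 0.6 s with hs6 | hs6
  · refine le_trans (div_le_one_of_le₀ (hMc _) hc0) (one_le_pow₀ (one_le_two_mul_div hs6 hs1))
  have hi0 : i ≠ 0 := by
    rintro rfl
    norm_num at hs
    norm_num [hs] at hs6
  have hs4 : s ^ 4 ≤ 13 / 100 := by
    have : s ^ 4 ≤ 0.6 ^ 4 := by gcongr
    norm_num at this
    linarith
  obtain ⟨d, hd, hz⟩ := exists_zolotarev_bound hκ1 hi0 hs hs4
  have hs40 : 0 < 1 + s ^ 4 := by positivity
  refine div_le_of_le_mul₀ hc0 (by positivity) ?_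
  -- This scaling sends the transform of the smallest eigenvalue to `1 / √κ`; it is absorbed into
  -- the shifts as `γ • d`.
  set γ := (2 - α * lₙ) / (α * lₙ * √κ) with hγ
  have hK' := Matrix.isSymmetric_toEuclideanLin_iff.mpr hK.isHermitian
  have hM' := Matrix.isSymmetric_toEuclideanLin_iff.mpr hM
  have hD' := Matrix.isSymmetric_toEuclideanLin_iff.mpr (isHermitian_stepMatrix hK.isHermitian α)
  have hαj : ∀ j, α * hK.isHermitian.eigenvalues₀ j < 1 := fun j =>
    (mul_le_mul_of_nonneg_left (hle₁ j) hα.le).trans_lt hαl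
  have hint := fun j => cayley_mem_interval hα hlₙ0 (hleₙ j) (hle₁ j) hαl hκ
  have hκs : 0 < √κ := Real.sqrt_pos.2 (by linarith)
  have hfin := eigenvalues_le_of_stein (m := 2) hD' hM' finrank_euclideanSpace
    (rank_stein_targetPCA_le K α y hT) (hK'.eigenvectorBasis finrank_euclideanSpace)
    (μ := fun j => 1 - α * hK.isHermitian.eigenvalues₀ j) (fun j => ?_) (d := γ • d) (k := i)
    (B := (2 * s / (1 + s ^ 4)) ^ 2) hc0 hMc (fun j => ?_) (fun j => ?_)
    (by rw [Fintype.card_fin]; omega)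
  · refine le_trans (le_of_eq ?_) hfin
    rw [eigDesc]
    exact congrArg hM.eigenvalues₀ (Fin.ext (by simp))
  · have h := hK'.apply_eigenvectorBasis finrank_euclideanSpace j
    rw [stepMatrix, map_sub, map_smul, Matrix.toLpLin_one, LinearMap.sub_apply,
      LinearMap.smul_apply, h, LinearMap.id_apply, sub_smul, one_smul, mul_smul]
    rfl
  · refine eval_adiPoly_sq_le (by linarith [hαj j]) ?_
    exact ((le_div_iff₀ hs40).2 (hz _ (hint j).1 (hint j).2)).trans_eq (by ring)
  · rw [eval_adiPoly]
    refine (Finset.prod_pos fun t _ => ?_).ne'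
    have hγ0 : 0 < γ := by
      have := hαj
      rw [hγ]
      exact div_pos (by nlinarith) (by positivity)
    have h1 : 0 < hK.isHermitian.eigenvalues₀ j := hlₙ0.trans_le (hleₙ j)
    have h2 : 0 < (γ • d) t * (1 - (1 - α * hK.isHermitian.eigenvalues₀ j)) := by
      rw [sub_sub_cancel]
      exact mul_pos (mul_pos hγ0 (hd t)) (mul_pos hα h1)
    linarith [hαj j]
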